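/- An instance $I$ of the Unbounded Knapsack Problem (UKP) consists of $n \ge 1$ items with real profits $p_j \in (0,1]$ and real sizes $s_j \in (0,1]$, $j = 1,\dots,n$; the knapsack has capacity $1$. A solution is a vector $x \in \mathbb{N}^n$ (with $0 \in \mathbb{N}$) such that $\sum_{j} s_j x_j \le 1$, its value is $\sum_j p_j x_j$, and $\mathrm{OPT}(I)$ is the maximum value of a solution. The model of computation is the unit-cost real RAM: a program has a fixed number of registers and of arrays, whose cells hold real numbers; the four basic arithmetic operations, rounding down to an integer, the logarithm, comparisons and accesses to array cells take one step each. Space is the total number of registers and array cells, including those for the input and the output. Theorem. There is an FPTAS for UKP with running time in $O\bigl(n + \frac{1}{\varepsilon^2}\log^3\frac1\varepsilon\bigr)$ and space complexity in $O\bigl(n + \frac1\varepsilon\log^2\frac1\varepsilon\bigr)$. Precisely: there are a single program and a constant $C$ such that for every UKP instance $I$ with $n \ge 1$ items and every real $\varepsilon > 0$, the program, given $I$ and $\varepsilon$, halts and returns a solution $x$ of $I$ with $$\sum_{j=1}^n p_j x_j \;\ge\; (1-\varepsilon)\,\mathrm{OPT}(I),$$ and it uses at most $C\bigl(n + \frac{1}{\varepsilon^2}(\log^+\frac1\varepsilon)^3\bigr)$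 steps and at most $C\bigl(n + \frac1\varepsilon(\log^+\frac1\varepsilon)^2\bigr)$ storage cells, where $\log^+ y = \max(0,\log y)$; thus $\log^+\frac1\varepsilon = \log\frac1\varepsilon$ for $\varepsilon \le 1$. -/

import Mathlib

/-! # The Unbounded Knapsack Problem -/

/-- An instance of the Unbounded Knapsack Problem: `n` items with profits and sizes in `(0,1]`.
The knapsack has capacity `1`. -/
structure UKP where
  n : ℕ
  profit : Fin n → ℝ
  size : Fin n → ℝ
  profit_mem : ∀ j, profit j ∈ Set.Ioc (0 : ℝ) 1
  size_mem : ∀ j, size j ∈ Set.Ioc (0 : ℝ) 1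

namespace UKP

/-- The multiplicities `x` describe a packing that fits into the knapsack. -/
def Feasible (I : UKP) (x : Fin I.n → ℕ) : Prop :=
  ∑ j, I.size j * (x j : ℝ) ≤ 1

/-- The total profit of the multiplicities `x`. -/
def value (I : UKP) (x : Fin I.n → ℕ) : ℝ :=
  ∑ j, I.profit j * (x j : ℝ)

/-- The optimum value of the instance; it is a maximum by `UKP.isGreatest_OPT`. -/
noncomputable def OPT (I : UKP) : ℝ :=
  sSup {v : ℝ | ∃ x : Fin I.n → ℕ, I.Feasible x ∧ v = I.value x}

theorem finite_feasible (I : UKP) : {x : Fin I.n → ℕ | I.Feasible x}.Finite := by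
  refine (Set.finite_Iic (fun j => ⌊1 / I.size j⌋₊)).subset ?_
  intro x hx j
  have hs := (I.size_mem j).1
  apply Nat.le_floor
  rw [le_div_iff₀ hs, mul_comm]
  refine le_trans ?_ (show ∑ j, I.size j * (x j : ℝ) ≤ 1 from hx)
  exact Finset.single_le_sum (f := fun j => I.size j * (x j : ℝ))
    (fun i _ => mul_nonneg (I.size_mem i).1.le (Nat.cast_nonneg _)) (Finset.mem_univ j)

theorem isGreatest_OPT (I : UKP) :
    IsGreatest {v : ℝ | ∃ x : Fin I.n → ℕ, I.Feasible x ∧ v = I.value x} I.OPT := by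
  have hfin : {v : ℝ | ∃ x : Fin I.n → ℕ, I.Feasible x ∧ v = I.value x}.Finite := by
    refine (I.finite_feasible.image I.value).subset ?_
    rintro v ⟨x, hx, rfl⟩
    exact ⟨x, hx, rfl⟩
  have hne : {v : ℝ | ∃ x : Fin I.n → ℕ, I.Feasible x ∧ v = I.value x}.Nonempty :=
    ⟨_, fun _ => 0, by simp [Feasible], rfl⟩
  exact ⟨hne.csSup_mem hfin, fun v hv => le_csSup hfin.bddAbove hv⟩

end UKP

/-! # The machine model: a unit-cost real random access machine

A machine has a fixed number `r` of registers and a fixed number `a` of arrays; every register and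
every array cell stores one real number.  Programs are finite, may contain natural number
constants only, and are the same for all inputs.  Arithmetic operations, rounding down, the
logarithm, comparisons and accesses to an array cell take one step each. -/

namespace RealRAM

/-- Arithmetic expressions over the registers. -/
inductive Expr (r : ℕ) : Type
  | lit (k : ℕ)
  | reg (i : Fin r)
  | add (e f : Expr r)
  | sub (e f : Expr r)
  | mul (e f : Expr r)
  | div (e f : Expr r)
  | floor (e : Expr r)
  | log (e : Expr r)

/-- The value of an expression.  (Real division and logarithm are total functions here; a
program could test for the exceptional arguments itself.) -/
noncomputable def Expr.eval {r : ℕ} (ρ : Fin r → ℝ) : Expr r → ℝ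
  | .lit k => (k : ℝ)
  | .reg i => ρ i
  | .add e f => e.eval ρ + f.eval ρ
  | .sub e f => e.eval ρ - f.eval ρ
  | .mul e f => e.eval ρ * f.eval ρ
  | .div e f => e.eval ρ / f.eval ρ
  | .floor e => ((⌊e.eval ρ⌋ : ℤ) : ℝ)
  | .log e => Real.logb 2 (e.eval ρ)

/-- The time for evaluating an expression: one step for every constant, every register that is
read, and every operation. -/
def Expr.cost {r : ℕ} : Expr r → ℕ
  | .lit _ => 1
  | .reg _ => 1
  | .add e f => e.cost + f.cost + 1
  | .sub e f => e.cost + f.cost + 1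
  | .mul e f => e.cost + f.cost + 1
  | .div e f => e.cost + f.cost + 1
  | .floor e => e.cost + 1
  | .log e => e.cost + 1

/-- Comparisons of two expressions. -/
inductive Test (r : ℕ) : Type
  | le (e f : Expr r)
  | lt (e f : Expr r)

/-- The comparison is true. -/
def Test.Holds {r : ℕ} (ρ : Fin r → ℝ) : Test r → Prop
  | .le e f => e.eval ρ ≤ f.eval ρ
  | .lt e f => e.eval ρ < f.eval ρ

/-- The time for a comparison. -/
def Test.cost {r : ℕ} : Test r → ℕ
  | .le e f => e.cost + f.cost + 1
  | .lt e f => e.cost + f.cost + 1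

/-- Programs with `r` registers and `a` arrays: `assign i e` sets register `i` to `e`,
`load i A e` sets register `i` to `A[e]`, `store A e f` sets `A[e]` to `f`. -/
inductive Prog (r a : ℕ) : Type
  | skip
  | assign (i : Fin r) (e : Expr r)
  | load (i : Fin r) (A : Fin a) (e : Expr r)
  | store (A : Fin a) (e f : Expr r)
  | seq (P Q : Prog r a)
  | branch (b : Test r) (P Q : Prog r a)
  | loop (b : Test r) (P : Prog r a)

/-- The contents of the registers and of the arrays. -/
structure State (r a : ℕ) where
  reg : Fin r → ℝ
  arr : Fin a → ℕ → ℝ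

/-- `Exec S P σ t τ`: the program `P`, started in the state `σ` with arrays of `S` cells each
(numbered `0, …, S - 1`), halts after exactly `t` steps in the state `τ`.  An access to a cell
whose number is not a natural number below `S` is not possible; a program that attempts it does
not halt properly. -/
inductive Exec {r a : ℕ} (S : ℕ) : Prog r a → State r a → ℕ → State r a → Prop
  | skip (σ : State r a) : Exec S .skip σ 1 σ
  | assign (i : Fin r) (e : Expr r) (σ : State r a) :
      Exec S (.assign i e) σ (e.cost + 1) ⟨Function.update σ.reg i (e.eval σ.reg), σ.arr⟩
  | load (i : Fin r) (A : Fin a) (e : Expr r) (σ : State r a) (k : ℕ)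
      (haddr : e.eval σ.reg = (k : ℝ)) (hk : k < S) :
      Exec S (.load i A e) σ (e.cost + 1) ⟨Function.update σ.reg i (σ.arr A k), σ.arr⟩
  | store (A : Fin a) (e f : Expr r) (σ : State r a) (k : ℕ)
      (haddr : e.eval σ.reg = (k : ℝ)) (hk : k < S) :
      Exec S (.store A e f) σ (e.cost + f.cost + 1)
        ⟨σ.reg, Function.update σ.arr A (Function.update (σ.arr A) k (f.eval σ.reg))⟩
  | seq (P Q : Prog r a) (σ τ υ : State r a) (t u : ℕ)
      (hP : Exec S P σ t τ) (hQ : Exec S Q τ u υ) : Exec S (.seq P Q) σ (t + u) υ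
  | branch_true (b : Test r) (P Q : Prog r a) (σ τ : State r a) (t : ℕ)
      (hb : b.Holds σ.reg) (hP : Exec S P σ t τ) : Exec S (.branch b P Q) σ (b.cost + t) τ
  | branch_false (b : Test r) (P Q : Prog r a) (σ τ : State r a) (t : ℕ)
      (hb : ¬ b.Holds σ.reg) (hQ : Exec S Q σ t τ) : Exec S (.branch b P Q) σ (b.cost + t) τ
  | loop_true (b : Test r) (P : Prog r a) (σ τ υ : State r a) (t u : ℕ)
      (hb : b.Holds σ.reg) (hP : Exec S P σ t τ) (hL : Exec S (.loop b P) τ u υ) :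
      Exec S (.loop b P) σ (b.cost + t + u) υ
  | loop_false (b : Test r) (P : Prog r a) (σ : State r a)
      (hb : ¬ b.Holds σ.reg) : Exec S (.loop b P) σ b.cost σ

/-- The initial state for the instance `I` and the accuracy `ε`: register `0` holds `ε`,
register `1` holds the number `n` of items, array `0` holds the profits and array `1` the sizes.
Everything else is `0`. -/
noncomputable def initState (r a : ℕ) (I : UKP) (ε : ℝ) : State (r + 2) (a + 3) where
  reg := Function.update (Function.update (fun _ => 0) 0 ε) 1 (I.n : ℝ)
  arr := Function.update
    (Function.update (fun _ _ => 0) 0 (fun j => if h : j < I.n then I.profit ⟨j, h⟩ else 0))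
    1 (fun j => if h : j < I.n then I.size ⟨j, h⟩ else 0)

/-- On the input `(I, ε)` the program halts after exactly `T` steps, with the multiplicities `x`
in the first `n` cells of array `2`.  It uses in total `M` storage cells: its registers, and
its arrays, which have a common length that at least suffices for the input and the output. -/
def Computes {r a : ℕ} (P : Prog (r + 2) (a + 3)) (I : UKP) (ε : ℝ) (T M : ℕ)
    (x : Fin I.n → ℕ) : Prop :=
  ∃ (S : ℕ) (τ : State (r + 2) (a + 3)),
    I.n ≤ S ∧ M = (r + 2) + (a + 3) * S ∧
    Exec S P (initState r a I ε) T τ ∧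
    ∀ j : Fin I.n, τ.arr 2 (j : ℕ) = (x j : ℝ)

end RealRAM

/-! Let P be the best profit obtained from copies of a single item. Since ⌊1/s⌋ ≥ 1/(2s) for sizes s
≤ 1, each packing has value at most 2P, so P ≤ OPT ≤ 2P (`value_le_two_mul`,
`profit_mul_floor_le_OPT`). Put e = min(ε, 1/2), K = ⌊log₂(1/e)⌋ + 3 and T = 2P/2^K ≤ eP/2. Of the
items with profit at most T only the most efficient one is kept; filling the free capacity with
copies of it loses at most T (`exists_good_cell`, `BestSmall.fill`).

The large items are handled by halving. In a packing take a part that is maximal among those of at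
most half the value; one more item passes the half, so the remainder is at most half as well
(`exists_split`). Hence a packing of value at most 2^(k+1)·T consists of two packings of value at
most 2^k·T and at most one item. The table of level k has unit 2^k·T/m, and its entry i ≤ m is the
size of some packing of value at least i units. As the unit doubles together with the range of
values, every table has only m + 1 entries. The next table arises by combining the table with itself
and the result with a table of single items. A level costs fewer than three new units, and the old
errors keep their number of units because the unit doubles (`Complete.step`). The 3K units lost in
the end are at most eP/2 for m = 12K(⌊1/e⌋ + 1). For single items it suffices to keep the smallest
item of each profit class of ratio 2^(1/m) (`mul_le_of_bucket_eq`, `ItemInv.complete`).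

K levels with O(m²) pairs each give the time, and O(Km) cells give the space. No cell holds a
packing explicitly: it names an item or points to two earlier cells. The chosen packing is recovered
by one downward sweep with multiplicity counters (`BackInv.node`). The program itself is verified by
weakest preconditions and a rule for counting loops (`runs_of_wp`, `runs_forLoop`). -/

namespace RealRAM

/-! ### A program logic with time bounds for the machine. -/

section Framework

variable {r a : ℕ}

/-- The program never assigns to the register `i`. -/
def Prog.keepsReg (i : Fin r) : Prog r a → Bool
  | .skip => true
  | .assign j _ => i ≠ j
  | .load j _ _ => i ≠ j
  | .store _ _ _ => true
  | .seq P Q => P.keepsReg i && Q.keepsReg i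
  | .branch _ P Q => P.keepsReg i && Q.keepsReg i
  | .loop _ P => P.keepsReg i

/-- The program never writes to the array `A`. -/
def Prog.keepsArr (A : Fin a) : Prog r a → Bool
  | .skip => true
  | .assign _ _ => true
  | .load _ _ _ => true
  | .store B _ _ => A ≠ B
  | .seq P Q => P.keepsArr A && Q.keepsArr A
  | .branch _ P Q => P.keepsArr A && Q.keepsArr A
  | .loop _ P => P.keepsArr A

/-- `τ` agrees with `σ` on everything that the program cannot write to. -/
structure Frame (P : Prog r a) (σ τ : State r a) : Prop where
  reg : ∀ i, P.keepsReg i = true → τ.reg i = σ.reg i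
  arr : ∀ A, P.keepsArr A = true → τ.arr A = σ.arr A

/-- Whether a program can write to a register or array is decided by its syntax. Invariants can
therefore be confined to what changes; everything else is carried over by evaluating `keepsReg` and
`keepsArr`. -/
theorem Exec.frame {S : ℕ} {P : Prog r a} {σ τ : State r a} {t : ℕ} (h : Exec S P σ t τ) :
    Frame P σ τ := by
  induction h with
  | skip σ => exact ⟨fun _ _ => rfl, fun _ _ => rfl⟩
  | assign i e σ =>
    refine ⟨fun j hj => ?_, fun _ _ => rfl⟩
    simp only [Prog.keepsReg, ne_eq, decide_eq_true_eq] at hj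
    exact Function.update_of_ne hj _ _
  | load i A e σ k _ _ =>
    refine ⟨fun j hj => ?_, fun _ _ => rfl⟩
    simp only [Prog.keepsReg, ne_eq, decide_eq_true_eq] at hj
    exact Function.update_of_ne hj _ _
  | store A e f σ k _ _ =>
    refine ⟨fun _ _ => rfl, fun B hB => ?_⟩
    simp only [Prog.keepsArr, ne_eq, decide_eq_true_eq] at hB
    exact Function.update_of_ne hB _ _
  | seq P Q σ τ υ t u _ _ ihP ihQ =>
    refine ⟨fun j hj => ?_, fun B hB => ?_⟩
    · simp only [Prog.keepsReg, Bool.and_eq_true] at hj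
      rw [ihQ.reg j hj.2, ihP.reg j hj.1]
    · simp only [Prog.keepsArr, Bool.and_eq_true] at hB
      rw [ihQ.arr B hB.2, ihP.arr B hB.1]
  | branch_true b P Q σ τ t _ _ ih =>
    refine ⟨fun j hj => ?_, fun B hB => ?_⟩
    · simp only [Prog.keepsReg, Bool.and_eq_true] at hj
      exact ih.reg j hj.1
    · simp only [Prog.keepsArr, Bool.and_eq_true] at hB
      exact ih.arr B hB.1
  | branch_false b P Q σ τ t _ _ ih =>
    refine ⟨fun j hj => ?_, fun B hB => ?_⟩
    · simp only [Prog.keepsReg, Bool.and_eq_true] at hj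
      exact ih.reg j hj.2
    · simp only [Prog.keepsArr, Bool.and_eq_true] at hB
      exact ih.arr B hB.2
  | loop_true b P σ τ υ t u _ _ _ ihP ihL =>
    refine ⟨fun j hj => ?_, fun B hB => ?_⟩
    · rw [ihL.reg j hj, ihP.reg j hj]
    · rw [ihL.arr B hB, ihP.arr B hB]
  | loop_false b P σ _ => exact ⟨fun _ _ => rfl, fun _ _ => rfl⟩

/-- Total correctness: started in `σ`, the program halts within `t` steps in a state with `Q`. -/
def Runs (S : ℕ) (P : Prog r a) (σ : State r a) (t : ℕ) (Q : State r a → Prop) : Prop :=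
  ∃ t' ≤ t, ∃ τ, Exec S P σ t' τ ∧ Q τ

theorem Runs.mono {S : ℕ} {P : Prog r a} {σ : State r a} {t t' : ℕ} {Q Q' : State r a → Prop}
    (h : Runs S P σ t Q) (ht : t ≤ t') (hQ : ∀ τ, Frame P σ τ → Q τ → Q' τ) :
    Runs S P σ t' Q' := by
  obtain ⟨s, hs, τ, he, hq⟩ := h
  exact ⟨s, hs.trans ht, τ, he, hQ τ he.frame hq⟩

theorem Runs.seq {S : ℕ} {P P' : Prog r a} {σ : State r a} {t t' : ℕ} {Q Q' : State r a → Prop}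
    (h : Runs S P σ t Q) (h' : ∀ τ, Frame P σ τ → Q τ → Runs S P' τ t' Q') :
    Runs S (.seq P P') σ (t + t') Q' := by
  obtain ⟨s, hs, τ, he, hq⟩ := h
  obtain ⟨s', hs', υ, he', hq'⟩ := h' τ he.frame hq
  exact ⟨s + s', by omega, υ, .seq _ _ _ _ _ _ _ he he', hq'⟩

/-- The weakest precondition of a program without loops. -/
def wp (S : ℕ) : Prog r a → (State r a → Prop) → State r a → Prop
  | .skip, Q, σ => Q σ
  | .assign i e, Q, σ => Q ⟨Function.update σ.reg i (e.eval σ.reg), σ.arr⟩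
  | .load i A e, Q, σ => ∃ k : ℕ, e.eval σ.reg = (k : ℝ) ∧ k < S ∧
      Q ⟨Function.update σ.reg i (σ.arr A k), σ.arr⟩
  | .store A e f, Q, σ => ∃ k : ℕ, e.eval σ.reg = (k : ℝ) ∧ k < S ∧
      Q ⟨σ.reg, Function.update σ.arr A (Function.update (σ.arr A) k (f.eval σ.reg))⟩
  | .seq P P', Q, σ => wp S P (wp S P' Q) σ
  | .branch b P P', Q, σ => (b.Holds σ.reg → wp S P Q σ) ∧ (¬ b.Holds σ.reg → wp S P' Q σ)
  | .loop _ _, _, _ => False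

/-- An upper bound for the running time of a program without loops. -/
def Prog.cost : Prog r a → ℕ
  | .skip => 1
  | .assign _ e => e.cost + 1
  | .load _ _ e => e.cost + 1
  | .store _ e f => e.cost + f.cost + 1
  | .seq P Q => P.cost + Q.cost
  | .branch b P Q => b.cost + (P.cost + Q.cost)
  -- The value is irrelevant: `wp` is `False` for loops.
  | .loop _ _ => 0

theorem runs_of_wp {S : ℕ} {P : Prog r a} {σ : State r a} {t : ℕ} {Q : State r a → Prop}
    (h : wp S P Q σ) (ht : P.cost ≤ t) : Runs S P σ t Q := by
  refine Runs.mono (t := P.cost) (Q := Q) ?_ ht (fun _ _ h => h)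
  clear ht t
  induction P generalizing σ Q with
  | skip => exact ⟨1, le_rfl, σ, .skip _, h⟩
  | assign i e => exact ⟨_, le_rfl, _, .assign _ _ _, h⟩
  | load i A e =>
    obtain ⟨k, hk, hS, hQ⟩ := h
    exact ⟨_, le_rfl, _, .load _ _ _ _ k hk hS, hQ⟩
  | store A e f =>
    obtain ⟨k, hk, hS, hQ⟩ := h
    exact ⟨_, le_rfl, _, .store _ _ _ _ k hk hS, hQ⟩
  | seq P P' ihP ihP' => exact (ihP h).seq fun τ _ hτ => ihP' hτ
  | branch b P P' ihP ihP' =>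
    by_cases hb : b.Holds σ.reg
    · obtain ⟨s, hs, τ, he, hq⟩ := ihP (h.1 hb)
      exact ⟨_, by simp only [Prog.cost]; omega, τ, .branch_true _ _ _ _ _ _ hb he, hq⟩
    · obtain ⟨s, hs, τ, he, hq⟩ := ihP' (h.2 hb)
      exact ⟨_, by simp only [Prog.cost]; omega, τ, .branch_false _ _ _ _ _ _ hb he, hq⟩
  | loop b P => exact h.elim

/-- `for i = 0, …, N - 1 do P`, where `N` is the contents of register `b`. -/
def forLoop (i b : Fin r) (P : Prog r a) : Prog r a :=
  .seq (.assign i (.lit 0))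
    (.loop (.lt (.reg i) (.reg b)) (.seq P (.assign i (.add (.reg i) (.lit 1)))))

/-- Each round pays 3 steps for the test and 4 for the increment besides the body; the summand 5 is
the initial assignment and the last, failing test. The frame of the whole loop is handed to every
round, so constants of the loop need not be part of the invariant. -/
theorem runs_forLoop {S : ℕ} {i b : Fin r} {P : Prog r a} {σ : State r a} {N t : ℕ}
    (Inv : ℕ → State r a → Prop) (hN : σ.reg b = N) (hib : b ≠ i)
    (hi : P.keepsReg i = true) (hb : P.keepsReg b = true)
    (h0 : Inv 0 ⟨Function.update σ.reg i 0, σ.arr⟩)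
    (hstep : ∀ k < N, ∀ τ : State r a, τ.reg i = (k : ℝ) → Frame (forLoop i b P) σ τ → Inv k τ →
      Runs S P τ t fun υ => Inv (k + 1) ⟨Function.update υ.reg i (k + 1 : ℕ), υ.arr⟩) :
    Runs S (forLoop i b P) σ (N * (t + 7) + 5) (Inv N) := by
  have hframe : ∀ τ : State r a,
      Frame (Prog.loop (.lt (.reg i) (.reg b)) (.seq P (.assign i (.add (.reg i) (.lit 1)))))
        ⟨Function.update σ.reg i 0, σ.arr⟩ τ → Frame (forLoop i b P) σ τ := by
    intro τ h
    refine ⟨fun j hj => ?_, fun A hA => ?_⟩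
    · simp only [forLoop, Prog.keepsReg, Bool.and_eq_true] at hj
      rw [h.reg j (by simpa [Prog.keepsReg] using hj.2)]
      have : j ≠ i := by simpa using hj.1
      exact Function.update_of_ne this _ _
    · simp only [forLoop, Prog.keepsArr, Bool.and_eq_true] at hA
      rw [h.arr A (by simpa [Prog.keepsArr] using hA.2)]
  have key : ∀ d k : ℕ, k + d = N → ∀ τ : State r a, τ.reg i = (k : ℝ) →
      Frame (Prog.loop (.lt (.reg i) (.reg b)) (.seq P (.assign i (.add (.reg i) (.lit 1)))))
        ⟨Function.update σ.reg i 0, σ.arr⟩ τ → Inv k τ →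
      Runs S (.loop (.lt (.reg i) (.reg b)) (.seq P (.assign i (.add (.reg i) (.lit 1)))))
        τ (d * (t + 7) + 3) (Inv N) := by
    intro d
    induction d with
    | zero =>
      intro k hk τ hτ hf hinv
      obtain rfl : k = N := by omega
      refine ⟨3, by omega, τ, .loop_false _ _ _ ?_, hinv⟩
      have := (hframe τ hf).reg b (by simp [forLoop, Prog.keepsReg, hib, hb])
      simp [Test.Holds, Expr.eval, hτ, this, hN]
    | succ d ih =>
      intro k hk τ hτ hf hinv
      obtain ⟨s, hs, υ, he, hq⟩ := hstep k (by omega) τ hτ (hframe τ hf) hinv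
      have hυ : υ.reg i = k := by rw [he.frame.reg i hi, hτ]
      have he2 : Exec S (.seq P (.assign i (.add (.reg i) (.lit 1)))) τ (s + 4)
          ⟨Function.update υ.reg i (k + 1 : ℕ), υ.arr⟩ := by
        refine .seq _ _ _ _ _ _ _ he ?_
        have := Exec.assign (S := S) i (.add (.reg i) (.lit 1)) υ
        simpa [Expr.eval, Expr.cost, hυ] using this
      have hf2 := he2.frame
      obtain ⟨s', hs', ω, he', hq'⟩ := ih (k + 1) (by omega)
        ⟨Function.update υ.reg i (k + 1 : ℕ), υ.arr⟩ (by simp)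
        ⟨fun j hj => by rw [hf2.reg j hj, hf.reg j hj], fun A hA => by
          rw [hf2.arr A hA, hf.arr A hA]⟩ hq
      have hb' := (hframe τ hf).reg b (by simp [forLoop, Prog.keepsReg, hib, hb])
      refine ⟨3 + (s + 4) + s', by linarith, ω, .loop_true _ _ _ _ _ _ _ ?_ he2 he', hq'⟩
      simp only [Test.Holds, Expr.eval, hτ, hb', hN]
      exact_mod_cast (by omega : k < N)
  have hassign : Runs S (Prog.assign i (.lit 0) : Prog r a) σ 2
      (fun τ => τ = ⟨Function.update σ.reg i 0, σ.arr⟩) :=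
    runs_of_wp (by simp [wp, Expr.eval]) le_rfl
  refine Runs.mono (hassign.seq (t' := N * (t + 7) + 3) (Q' := Inv N) ?_) (by omega)
    (fun _ _ h => h)
  rintro τ - rfl
  exact key N 0 (by omega) _ (by simp) ⟨fun _ _ => rfl, fun _ _ => rfl⟩ h0

end Framework

end RealRAM

/-! ### Packings: halving, and the factor two bound from a single item type. -/

namespace UKP

variable (I : UKP)

/-- The total size of the multiplicities `x`. -/
def weight (x : Fin I.n → ℕ) : ℝ :=
  ∑ j, I.size j * (x j : ℝ)

@[simp] theorem value_zero : I.value 0 = 0 := by simp [value]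

@[simp] theorem weight_zero : I.weight 0 = 0 := by simp [weight]

theorem value_add (x y : Fin I.n → ℕ) : I.value (x + y) = I.value x + I.value y := by
  simp [value, mul_add, Finset.sum_add_distrib]

theorem weight_add (x y : Fin I.n → ℕ) : I.weight (x + y) = I.weight x + I.weight y := by
  simp [weight, mul_add, Finset.sum_add_distrib]

theorem value_single (j : Fin I.n) (k : ℕ) : I.value (Pi.single j k) = I.profit j * k := by
  simp [value, Pi.single_apply]

theorem weight_single (j : Fin I.n) (k : ℕ) : I.weight (Pi.single j k) = I.size j * k := by
  simp [weight, Pi.single_apply]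

theorem weight_nonneg (x : Fin I.n → ℕ) : 0 ≤ I.weight x :=
  Finset.sum_nonneg fun j _ => mul_nonneg (I.size_mem j).1.le (Nat.cast_nonneg _)

theorem value_nonneg (x : Fin I.n → ℕ) : 0 ≤ I.value x :=
  Finset.sum_nonneg fun j _ => mul_nonneg (I.profit_mem j).1.le (Nat.cast_nonneg _)

theorem profit_mul_le_value (x : Fin I.n → ℕ) (j : Fin I.n) : I.profit j * x j ≤ I.value x :=
  Finset.single_le_sum (f := fun j => I.profit j * (x j : ℝ))
    (fun i _ => mul_nonneg (I.profit_mem i).1.le (Nat.cast_nonneg _)) (Finset.mem_univ j)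

theorem value_pos {x : Fin I.n → ℕ} (hx : x ≠ 0) : 0 < I.value x := by
  obtain ⟨j, hj⟩ := Function.ne_iff.mp hx
  refine lt_of_lt_of_le (mul_pos (I.profit_mem j).1 ?_) (I.profit_mul_le_value x j)
  exact_mod_cast Nat.pos_of_ne_zero hj

/-- Every packing splits into two parts of at most half the value and at most one item. -/
theorem exists_split (x : Fin I.n → ℕ) :
    ∃ y z w : Fin I.n → ℕ, x = y + z + w ∧ I.value y ≤ I.value x / 2 ∧
      I.value w ≤ I.value x / 2 ∧ (z = 0 ∨ ∃ j, z = Pi.single j 1) := by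
  classical
  by_cases hx : x = 0
  · exact ⟨0, 0, 0, by simp [hx], by simp [hx], by simp [hx], Or.inl rfl⟩
  have hV := I.value_pos hx
  -- By maximality of `y`, any further item of `x` lifts the value above one half, so the rest is
  -- worth less than one half.
  obtain ⟨y, hy, hmax⟩ := Finset.exists_max_image
    ((Finset.Iic x).filter fun y => I.value y ≤ I.value x / 2) I.value
    ⟨0, by simp only [Finset.mem_filter, Finset.mem_Iic, value_zero]
           exact ⟨fun _ => Nat.zero_le _, by linarith⟩⟩
  simp only [Finset.mem_filter, Finset.mem_Iic] at hy hmax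
  have hne : ∃ j, y j < x j := by
    by_contra! h
    have : y = x := le_antisymm hy.1 h
    rw [this] at hy
    linarith [hy.2]
  obtain ⟨j, hj⟩ := hne
  have hle : y + Pi.single j 1 ≤ x := by
    intro i
    by_cases hi : i = j
    · subst hi; simpa using hj
    · simpa [Pi.single_apply, hi] using hy.1 i
  have hsum : x = y + Pi.single j 1 + (x - (y + Pi.single j 1)) := by
    funext i
    have := hle i
    simp only [Pi.add_apply, Pi.sub_apply] at this ⊢
    omega
  have hbig : I.value x / 2 < I.value (y + Pi.single j 1) := by
    by_contra! h
    have := hmax _ ⟨hle, h⟩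
    rw [value_add, value_single] at this
    have := (I.profit_mem j).1
    push_cast at *
    linarith
  refine ⟨y, Pi.single j 1, x - (y + Pi.single j 1), hsum, hy.2, ?_, Or.inr ⟨j, rfl⟩⟩
  have := congrArg I.value hsum
  rw [value_add] at this
  linarith

theorem half_div_le_floor {s : ℝ} (hs : s ∈ Set.Ioc (0 : ℝ) 1) :
    1 / s / 2 ≤ ((⌊1 / s⌋ : ℤ) : ℝ) := by
  have h1 : (1 : ℝ) ≤ 1 / s := by rw [le_div_iff₀ hs.1]; linarith [hs.2]
  have h2 : (1 : ℝ) ≤ ((⌊1 / s⌋ : ℤ) : ℝ) := by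
    exact_mod_cast Int.le_floor.mpr (by exact_mod_cast h1)
  have := Int.lt_floor_add_one (1 / s)
  linarith

/-- Packing copies of one item is at least half as good as every solution. -/
theorem value_le_two_mul {P : ℝ} (hP : ∀ j, I.profit j * ((⌊1 / I.size j⌋ : ℤ) : ℝ) ≤ P)
    (hP0 : 0 ≤ P) {x : Fin I.n → ℕ} (hx : I.weight x ≤ 1) : I.value x ≤ 2 * P := by
  have h1 : I.value x ≤ ∑ j, 2 * P * (I.size j * (x j : ℝ)) := by
    refine Finset.sum_le_sum fun j _ => ?_
    have hs := I.size_mem j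
    -- The efficiency of each item is at most 2P, because ⌊1/s⌋ is at least half of 1/s; total size
    -- at most 1 then gives the claim.
    have h2 : I.profit j ≤ 2 * P * I.size j := by
      have h3 := mul_le_mul_of_nonneg_left (half_div_le_floor hs) (I.profit_mem j).1.le
      have h4 := h3.trans (hP j)
      have h5 : I.profit j * (1 / I.size j / 2) * (2 * I.size j) = I.profit j := by
        have := hs.1.ne'
        field_simp
      have h6 := mul_le_mul_of_nonneg_right h4 (show 0 ≤ 2 * I.size j by linarith [hs.1])
      linarith
    have := mul_le_mul_of_nonneg_right h2 (Nat.cast_nonneg (α := ℝ) (x j))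
    linarith
  rw [← Finset.mul_sum] at h1
  have : 2 * P * I.weight x ≤ 2 * P * 1 := mul_le_mul_of_nonneg_left hx (by linarith)
  unfold weight at this
  linarith

theorem profit_mul_floor_le_OPT (j : Fin I.n) :
    I.profit j * ((⌊1 / I.size j⌋ : ℤ) : ℝ) ≤ I.OPT := by
  have hs := I.size_mem j
  have h0 : (0 : ℝ) ≤ 1 / I.size j := by have := hs.1; positivity
  rw [← natCast_floor_eq_intCast_floor h0, ← value_single]
  refine I.isGreatest_OPT.2 ⟨_, ?_, rfl⟩
  change I.weight _ ≤ 1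
  rw [weight_single]
  have := mul_le_mul_of_nonneg_left (Nat.floor_le h0) hs.1.le
  rwa [mul_one_div, div_self hs.1.ne'] at this

theorem profit_le_mul_floor (j : Fin I.n) :
    I.profit j ≤ I.profit j * ((⌊1 / I.size j⌋ : ℤ) : ℝ) := by
  have hs := I.size_mem j
  have h1 : (1 : ℝ) ≤ 1 / I.size j := by rw [le_div_iff₀ hs.1]; linarith [hs.2]
  have h2 : (1 : ℝ) ≤ ((⌊1 / I.size j⌋ : ℤ) : ℝ) := by
    exact_mod_cast Int.le_floor.mpr (by exact_mod_cast h1)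
  have := (I.profit_mem j).1
  nlinarith

end UKP

/-! ### Profit classes on a logarithmic scale. -/

section Buckets

/-- Profits above `T` are sorted into buckets on a logarithmic scale. -/
noncomputable def bucket (m : ℕ) (T p : ℝ) : ℕ := ⌊(m : ℝ) * Real.logb 2 (p / T)⌋₊

theorem logb_div_nonneg {T p : ℝ} (hT : 0 < T) (hp : T < p) : 0 ≤ Real.logb 2 (p / T) :=
  Real.logb_nonneg (by norm_num) (by rw [le_div_iff₀ hT]; linarith)

theorem floor_eq_bucket (m : ℕ) {T p : ℝ} (hT : 0 < T) (hp : T < p) :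
    ((⌊(m : ℝ) * Real.logb 2 (p / T)⌋ : ℤ) : ℝ) = (bucket m T p : ℝ) :=
  (natCast_floor_eq_intCast_floor
    (mul_nonneg (Nat.cast_nonneg _) (logb_div_nonneg hT hp))).symm

theorem bucket_lt {m K : ℕ} (hm : 0 < m) {T p : ℝ} (hT : 0 < T) (hp : T < p)
    (hK : p < 2 ^ K * T) : bucket m T p < m * K := by
  rw [bucket, Nat.floor_lt (mul_nonneg (Nat.cast_nonneg _) (logb_div_nonneg hT hp))]
  push_cast
  have hm' : (0 : ℝ) < m := by exact_mod_cast hm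
  refine mul_lt_mul_of_pos_left ?_ hm'
  rw [Real.logb_lt_iff_lt_rpow (by norm_num) (div_pos (hT.trans hp) hT), div_lt_iff₀ hT]
  simpa using hK

/-- Profits in the same bucket are almost equal. -/
theorem mul_le_of_bucket_eq {m : ℕ} (hm : 0 < m) {T p q : ℝ} (hT : 0 < T) (hp : T < p)
    (hq : T < q) (h : bucket m T p = bucket m T q) : p * (1 - 1 / m) ≤ q := by
  have hm' : (0 : ℝ) < m := by exact_mod_cast hm
  have hp0 := hT.trans hp
  have hq0 := hT.trans hq
  have h1 : (m : ℝ) * Real.logb 2 (p / T) < bucket m T p + 1 := Nat.lt_floor_add_one _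
  have h2 : (bucket m T q : ℝ) ≤ (m : ℝ) * Real.logb 2 (q / T) :=
    Nat.floor_le (mul_nonneg (Nat.cast_nonneg _) (logb_div_nonneg hT hq))
  rw [h] at h1
  have h3 : (m : ℝ) * (Real.logb 2 (p / T) - Real.logb 2 (q / T)) < 1 := by linarith
  -- Binary logarithms in one class differ by less than 1/m; as log 2 ≤ 1, so do the natural ones,
  -- and exp(-1/m) ≥ 1 - 1/m.
  have hl2 : (0 : ℝ) < Real.log 2 := Real.log_pos (by norm_num)
  have hl2' : Real.log 2 ≤ 1 := by
    have := Real.log_le_sub_one_of_pos (show (0 : ℝ) < 2 by norm_num)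
    linarith
  rw [Real.logb, Real.logb, Real.log_div hp0.ne' hT.ne', Real.log_div hq0.ne' hT.ne', ← sub_div,
    mul_div_assoc', div_lt_iff₀ hl2] at h3
  have h4 : Real.log p - 1 / m ≤ Real.log q := by
    have : (m : ℝ) * (Real.log p - Real.log q) ≤ 1 := by linarith
    have := (le_div_iff₀' hm').mpr this
    linarith
  calc p * (1 - 1 / m) ≤ p * Real.exp (-(1 / m)) := by
        refine mul_le_mul_of_nonneg_left ?_ hp0.le
        have := Real.add_one_le_exp (-(1 / (m : ℝ)))
        linarith
    _ = Real.exp (Real.log p - 1 / m) := by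
        rw [sub_eq_add_neg, Real.exp_add, Real.exp_log hp0]
    _ ≤ Real.exp (Real.log q) := Real.exp_le_exp.mpr h4
    _ = q := Real.exp_log hq0

end Buckets

/-! ### Approximation error of the size tables from level to level. -/

namespace UKP

variable (I : UKP)

/-- The size table `G`, for multiples of the unit `u`, approximates all packings of items of
profit above `T` up to an error of three units for each of `k` levels. -/
def Complete (T : ℝ) (m k : ℕ) (u : ℝ) (G : ℕ → ℝ) : Prop :=
  ∀ y : Fin I.n → ℕ, (∀ j, I.profit j ≤ T → y j = 0) → I.value y ≤ m * u →
    ∃ i ≤ m, I.value y - 3 * k * u ≤ i * u ∧ G i ≤ I.weight y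

/-- The size table `G`, for multiples of the unit `u`, approximates single items. -/
def ItemComplete (T : ℝ) (m : ℕ) (u : ℝ) (G : ℕ → ℝ) : Prop :=
  G 0 ≤ 0 ∧ ∀ j, T < I.profit j → I.profit j ≤ m * u →
    ∃ i ≤ m, I.profit j - 2 * u ≤ i * u ∧ G i ≤ I.size j

/-- The first table reaches only up to T, below the profit of any large item, so only the empty
packing has to be represented. -/
theorem Complete.zero {T : ℝ} {m : ℕ} {u : ℝ} {G : ℕ → ℝ} (hu : m * u ≤ T) (hG : G 0 ≤ 0) :
    I.Complete T m 0 u G := by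
  intro y hy hV
  have : y = 0 := by
    funext j
    by_contra hj
    have h1 : T < I.profit j := by
      by_contra! h
      exact hj (hy j h)
    have h2 := I.profit_mul_le_value y j
    have h3 : (1 : ℝ) ≤ y j := by exact_mod_cast Nat.pos_of_ne_zero hj
    have := (I.profit_mem j).1
    nlinarith
  subst this
  exact ⟨0, Nat.zero_le _, by simp, by simpa using hG⟩

/-- Split by `exists_split` and approximate both halves and the item. The halves lose 3k·u each,
that is 3k of the new units 2u; rounding (a + b)/2 down loses at most half a new unit and the item
at most two. The sum stays below 3(k + 1) new units. The division by 1 has the form in which `conv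
1` delivers its result. -/
theorem Complete.step {T : ℝ} {m k : ℕ} {u : ℝ} (hu : 0 < u) {G GI GD G' : ℕ → ℝ}
    (hG : I.Complete T m k u G) (hI : I.ItemComplete T m (2 * u) GI)
    (hD : ∀ a ≤ m, ∀ b ≤ m, GD (min m ((a + b) / 2)) ≤ G a + G b)
    (hG' : ∀ a ≤ m, ∀ b ≤ m, G' (min m ((a + b) / 1)) ≤ GD a + GI b) :
    I.Complete T m (k + 1) (2 * u) G' := by
  intro x hx hV
  obtain ⟨y, z, w, rfl, hy, hw, hz⟩ := I.exists_split x
  have hsum : ∀ j, I.profit j ≤ T → y j = 0 ∧ z j = 0 ∧ w j = 0 := by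
    intro j hj
    have := hx j hj
    simp only [Pi.add_apply] at this
    omega
  obtain ⟨a, ham, ha, ha'⟩ := hG y (fun j hj => (hsum j hj).1) (by linarith)
  obtain ⟨b, hbm, hb, hb'⟩ := hG w (fun j hj => (hsum j hj).2.2) (by linarith)
  have hzc : ∃ i ≤ m, I.value z - 2 * (2 * u) ≤ i * (2 * u) ∧ GI i ≤ I.weight z := by
    rcases hz with rfl | ⟨j, rfl⟩
    · exact ⟨0, Nat.zero_le _, by simp; linarith, by simpa using hI.1⟩
    · have hj : T < I.profit j := by
        by_contra! h
        have := (hsum j h).2.1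
        simp at this
      rw [value_single, weight_single]
      simp only [Nat.cast_one, mul_one]
      refine hI.2 j hj (le_trans ?_ hV)
      rw [value_add, value_add, value_single]
      have := I.value_nonneg y
      have := I.value_nonneg w
      simp only [Nat.cast_one, mul_one]
      linarith
  obtain ⟨c, hcm, hc, hc'⟩ := hzc
  rw [value_add, value_add] at hV ⊢
  rw [weight_add, weight_add]
  have hd := hD a ham b hbm
  have he := hG' (min m ((a + b) / 2)) (min_le_left _ _) c hcm
  refine ⟨_, min_le_left _ _, ?_, he.trans (by linarith)⟩
  have hab : (a : ℝ) + b ≤ 2 * ((a + b) / 2 : ℕ) + 1 := by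
    exact_mod_cast (by omega : a + b ≤ 2 * ((a + b) / 2) + 1)
  have hab' := mul_le_mul_of_nonneg_right hab hu.le
  have hku : 0 ≤ (k : ℝ) * u := by positivity
  rw [Nat.div_one] at he ⊢
  generalize (a + b) / 2 = d at *
  -- An index cut off at `m` is harmless, since the value is at most m units by assumption.
  rcases le_total m (min m d + c) with h | h
  · rw [min_eq_left h]
    push_cast
    nlinarith
  · rw [min_eq_right h]
    rcases le_total m d with h' | h'
    · rw [min_eq_left h'] at h ⊢
      obtain rfl : c = 0 := by omega
      push_cast
      nlinarith
    · rw [min_eq_right h']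
      push_cast
      nlinarith

/-! ### The tables as an acyclic graph of packings. -/

variable {I}

/-- The cells `0, …, D - 1` of the arrays describe packings: cell `d` is an item (whose number
plus one is `J d`) or the sum of the packings of the cells `L d` and `R d`, which lie below `d`
and below `cur`.  The size is stored in `F d`; the value `2` means that it is not known. -/
structure Dag (I : UKP) (D cur : ℕ) (F L R J : ℕ → ℝ) (X : ℕ → Fin I.n → ℕ) : Prop where
  zero : X 0 = 0
  weight_eq : ∀ d < D, F d < 2 → F d = I.weight (X d)
  nonneg : ∀ d < D, 0 ≤ F d
  le_two : ∀ d < D, F d ≤ 2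
  node : ∀ d < D, (∃ j : Fin I.n, J d = (j : ℕ) + 1 ∧ X d = Pi.single j 1) ∨
    (J d = 0 ∧ ∃ a b : ℕ, L d = a ∧ R d = b ∧ a ≤ d - 1 ∧ b ≤ d - 1 ∧ a < cur ∧ b < cur ∧
      X d = X a + X b)

/-- The cells from `cur` on have not been used yet. -/
structure Fresh (D cur : ℕ) (F L R J : ℕ → ℝ) : Prop where
  size : ∀ d, cur ≤ d → d < D → F d = 2
  left : ∀ d, cur ≤ d → L d = 0
  right : ∀ d, cur ≤ d → R d = 0
  item : ∀ d, cur ≤ d → J d = 0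

/-- In the table at `base`, cell `i` has value at least `i * u`. -/
def Sound (I : UKP) (base m : ℕ) (u : ℝ) (F : ℕ → ℝ) (X : ℕ → Fin I.n → ℕ) : Prop :=
  ∀ i ≤ m, F (base + i) < 2 → i * u ≤ I.value (X (base + i))

theorem Fresh.mono {D c c' : ℕ} {F L R J : ℕ → ℝ} (h : Fresh D c F L R J) (hc : c ≤ c') :
    Fresh D c' F L R J :=
  ⟨fun d hd => h.size d (hc.trans hd), fun d hd => h.left d (hc.trans hd),
    fun d hd => h.right d (hc.trans hd), fun d hd => h.item d (hc.trans hd)⟩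

theorem Dag.mono {D c c' : ℕ} {F L R J : ℕ → ℝ} {X : ℕ → Fin I.n → ℕ}
    (h : Dag I D c F L R J X) (hc : c ≤ c') : Dag I D c' F L R J X := by
  refine ⟨h.zero, h.weight_eq, h.nonneg, h.le_two, fun d hd => (h.node d hd).imp_right ?_⟩
  rintro ⟨hJ, a, b, hL, hR, ha, hb, hac, hbc, hX⟩
  exact ⟨hJ, a, b, hL, hR, ha, hb, hac.trans_le hc, hbc.trans_le hc, hX⟩

theorem Sound.congr {base m D : ℕ} {u : ℝ} {F F' : ℕ → ℝ} {X X' : ℕ → Fin I.n → ℕ}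
    (h : Sound I base m u F X) (hD : base + m < D)
    (hF : ∀ d < D, F' d = F d ∧ X' d = X d) : Sound I base m u F' X' := by
  intro i hi hlt
  rw [(hF _ (by omega)).1] at hlt
  rw [(hF _ (by omega)).2]
  exact h i hi hlt

/-- All pointers lead below `cur`, so overwriting a cell from `cur` on changes no other packing. A
strict improvement on an entry that is at most 2 forces both summands below 2, hence both sizes are
genuine. -/
theorem Dag.setNode {D cur d a b : ℕ} {F L R J : ℕ → ℝ} {X : ℕ → Fin I.n → ℕ}
    (h : Dag I D cur F L R J X) (hd : cur ≤ d) (hdD : d < D) (hJ : J d = 0)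
    (ha : a < cur) (hb : b < cur) (hlt : F a + F b < F d) :
    Dag I D cur (Function.update F d (F a + F b)) (Function.update L d a)
      (Function.update R d b) J (Function.update X d (X a + X b)) := by
  have hd2 := h.le_two d hdD
  have ha0 := h.nonneg a (by omega)
  have hb0 := h.nonneg b (by omega)
  have hX : ∀ e < cur, Function.update X d (X a + X b) e = X e := fun e he =>
    Function.update_of_ne (by omega) _ _
  refine ⟨?_, fun e he => ?_, fun e he => ?_, fun e he => ?_, fun e he => ?_⟩
  · rw [hX 0 (by omega), h.zero]
  · by_cases hed : e = d
    · subst hed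
      simp only [Function.update_self]
      intro _
      rw [weight_add, ← h.weight_eq a (by omega) (by linarith),
        ← h.weight_eq b (by omega) (by linarith)]
    · simpa only [Function.update_of_ne hed] using h.weight_eq e he
  · by_cases hed : e = d
    · subst hed
      simp only [Function.update_self]
      linarith
    · simpa only [Function.update_of_ne hed] using h.nonneg e he
  · by_cases hed : e = d
    · subst hed
      simp only [Function.update_self]
      linarith
    · simpa only [Function.update_of_ne hed] using h.le_two e he
  · by_cases hed : e = d
    · subst hed
      refine Or.inr ⟨hJ, a, b, by simp, by simp, by omega, by omega, ha, hb, ?_⟩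
      rw [hX a ha, hX b hb, Function.update_self]
    · simp only [Function.update_of_ne hed]
      refine (h.node e he).imp_right ?_
      rintro ⟨hJ, a', b', hL, hR, ha', hb', hac, hbc, hXe⟩
      exact ⟨hJ, a', b', hL, hR, ha', hb', hac, hbc, by rw [hX a' hac, hX b' hbc, hXe]⟩

theorem Dag.setItem {D cur d : ℕ} {F L R J : ℕ → ℝ} {X : ℕ → Fin I.n → ℕ}
    (h : Dag I D cur F L R J X) (hcur : 0 < cur) (hd : cur ≤ d) (j : Fin I.n) :
    Dag I D cur (Function.update F d (I.size j)) L R (Function.update J d ((j : ℕ) + 1))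
      (Function.update X d (Pi.single j 1)) := by
  have hs := I.size_mem j
  have hX : ∀ e < cur, Function.update X d (Pi.single j 1) e = X e := fun e he =>
    Function.update_of_ne (by omega) _ _
  refine ⟨?_, fun e he => ?_, fun e he => ?_, fun e he => ?_, fun e he => ?_⟩
  · rw [hX 0 hcur, h.zero]
  · by_cases hed : e = d
    · subst hed
      simp [weight_single]
    · simpa only [Function.update_of_ne hed] using h.weight_eq e he
  · by_cases hed : e = d
    · subst hed
      simpa only [Function.update_self] using hs.1.le
    · simpa only [Function.update_of_ne hed] using h.nonneg e he
  · by_cases hed : e = d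
    · subst hed
      simp only [Function.update_self]
      linarith [hs.2]
    · simpa only [Function.update_of_ne hed] using h.le_two e he
  · by_cases hed : e = d
    · subst hed
      exact Or.inl ⟨j, by simp, by simp⟩
    · simp only [Function.update_of_ne hed]
      refine (h.node e he).imp_right ?_
      rintro ⟨hJ, a', b', hL, hR, ha', hb', hac, hbc, hXe⟩
      exact ⟨hJ, a', b', hL, hR, ha', hb', hac, hbc, by rw [hX a' hac, hX b' hbc, hXe]⟩

theorem Dag.setEmpty {D cur d : ℕ} {F L R J : ℕ → ℝ} {X : ℕ → Fin I.n → ℕ}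
    (h : Dag I D cur F L R J X) (hd : X d = 0) :
    Dag I D cur (Function.update F d 0) L R J X := by
  refine ⟨h.zero, fun e he => ?_, fun e he => ?_, fun e he => ?_, h.node⟩
  · by_cases hed : e = d
    · subst hed
      simp [hd]
    · simpa only [Function.update_of_ne hed] using h.weight_eq e he
  · by_cases hed : e = d
    · subst hed
      simp
    · simpa only [Function.update_of_ne hed] using h.nonneg e he
  · by_cases hed : e = d
    · subst hed
      simp
    · simpa only [Function.update_of_ne hed] using h.le_two e he

/-- An unused cell has both pointers at cell 0, the empty packing. This is why arrays full of zeros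
already form a valid graph. -/
theorem Dag.eq_zero_of_fresh {D cur d : ℕ} {F L R J : ℕ → ℝ} {X : ℕ → Fin I.n → ℕ}
    (h : Dag I D cur F L R J X) (hf : Fresh D cur F L R J) (hd : cur ≤ d) (hdD : d < D) :
    X d = 0 := by
  rcases h.node d hdD with ⟨j, hj, -⟩ | ⟨-, a, b, hL, hR, -, -, -, -, hX⟩
  · rw [hf.item d hd] at hj
    have : (0 : ℝ) ≤ (j : ℕ) := Nat.cast_nonneg _
    linarith
  · rw [hf.left d hd] at hL
    rw [hf.right d hd] at hR
    obtain rfl : a = 0 := by exact_mod_cast hL.symm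
    obtain rfl : b = 0 := by exact_mod_cast hR.symm
    simpa [h.zero] using hX

/-- The state of the combination of the tables at `A` and `B` into the table at `dst`, after the
pairs of indices that lie lexicographically before `(a, b)`. -/
def ConvInv (I : UKP) (D dst m c A B : ℕ) (u : ℝ) (F₀ : ℕ → ℝ) (X₀ : ℕ → Fin I.n → ℕ)
    (a b : ℕ) (F L R J : ℕ → ℝ) : Prop :=
  ∃ X, Dag I D dst F L R J X ∧ (∀ d < dst, F d = F₀ d ∧ X d = X₀ d) ∧
    Fresh D (dst + (m + 1)) F L R J ∧ (∀ d, dst ≤ d → J d = 0) ∧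
    Sound I dst m (c * u) F X ∧
    ∀ a' ≤ m, ∀ b' ≤ m, a' < a ∨ (a' = a ∧ b' < b) →
      F (dst + min m ((a' + b') / c)) ≤ F₀ (A + a') + F₀ (B + b')

theorem ConvInv.init {D dst m c A B : ℕ} {u : ℝ} {F L R J : ℕ → ℝ} {X : ℕ → Fin I.n → ℕ}
    (h : Dag I D dst F L R J X) (hf : Fresh D dst F L R J) (hD : dst + m < D) :
    ConvInv I D dst m c A B u F X 0 0 F L R J := by
  refine ⟨X, h, fun _ _ => ⟨rfl, rfl⟩, hf.mono (by omega), hf.item, fun i hi hlt => ?_, ?_⟩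
  · rw [hf.size _ (by omega) (by omega)] at hlt
    exact absurd hlt (lt_irrefl _)
  · intro a' _ b' _ h
    omega

theorem ConvInv.next {D dst m c A B : ℕ} {u : ℝ} {F₀ : ℕ → ℝ} {X₀ : ℕ → Fin I.n → ℕ}
    {a : ℕ} {F L R J : ℕ → ℝ} (h : ConvInv I D dst m c A B u F₀ X₀ a (m + 1) F L R J) :
    ConvInv I D dst m c A B u F₀ X₀ (a + 1) 0 F L R J := by
  obtain ⟨X, h1, h2, h3, h4, h5, h6⟩ := h
  exact ⟨X, h1, h2, h3, h4, h5, fun a' ha' b' hb' hlt => h6 a' ha' b' hb' (by omega)⟩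

theorem ConvInv.keep {D dst m c A B : ℕ} {u : ℝ} {F₀ : ℕ → ℝ} {X₀ : ℕ → Fin I.n → ℕ}
    {a b : ℕ} {F L R J : ℕ → ℝ} (h : ConvInv I D dst m c A B u F₀ X₀ a b F L R J)
    (hle : F (dst + min m ((a + b) / c)) ≤ F₀ (A + a) + F₀ (B + b)) :
    ConvInv I D dst m c A B u F₀ X₀ a (b + 1) F L R J := by
  obtain ⟨X, h1, h2, h3, h4, h5, h6⟩ := h
  refine ⟨X, h1, h2, h3, h4, h5, fun a' ha' b' hb' hlt => ?_⟩
  by_cases hab : a' = a ∧ b' = b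
  · obtain ⟨rfl, rfl⟩ := hab
    exact hle
  · exact h6 a' ha' b' hb' (by omega)

theorem ConvInv.set {D dst m c A B : ℕ} {u : ℝ} {F₀ : ℕ → ℝ} {X₀ : ℕ → Fin I.n → ℕ}
    {a b : ℕ} {F L R J : ℕ → ℝ} (hu : 0 ≤ u)
    (h : ConvInv I D dst m c A B u F₀ X₀ a b F L R J)
    (ha : a ≤ m) (hb : b ≤ m) (hA : A + m < dst) (hB : B + m < dst) (hD : dst + m < D)
    (hSA : Sound I A m u F₀ X₀) (hSB : Sound I B m u F₀ X₀)
    (hlt : F₀ (A + a) + F₀ (B + b) < F (dst + min m ((a + b) / c))) :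
    ConvInv I D dst m c A B u F₀ X₀ a (b + 1)
      (Function.update F (dst + min m ((a + b) / c)) (F₀ (A + a) + F₀ (B + b)))
      (Function.update L (dst + min m ((a + b) / c)) (A + a : ℕ))
      (Function.update R (dst + min m ((a + b) / c)) (B + b : ℕ)) J := by
  obtain ⟨X, h1, h2, h3, h4, h5, h6⟩ := h
  have hi : min m ((a + b) / c) ≤ m := min_le_left _ _
  have hi' : min m ((a + b) / c) ≤ (a + b) / c := min_le_right _ _
  -- Rounding the index down only understates the value, so soundness survives both the coarser unit
  -- and the cut at `m`.
  have hval : (min m ((a + b) / c) : ℕ) * (c * u) ≤ ((a : ℝ) + b) * u := by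
    have : min m ((a + b) / c) * c ≤ a + b :=
      (Nat.mul_le_mul_right _ hi').trans (Nat.div_mul_le_self _ _)
    have h7 : ((min m ((a + b) / c) * c : ℕ) : ℝ) ≤ (a + b : ℕ) := by exact_mod_cast this
    have := mul_le_mul_of_nonneg_right h7 hu
    push_cast at this ⊢
    linarith
  generalize hidx : min m ((a + b) / c) = i at *
  have hFA := h2 (A + a) (by omega)
  have hFB := h2 (B + b) (by omega)
  have hlt' := hlt
  rw [← hFA.1, ← hFB.1] at hlt'
  have hA0 := h1.nonneg (A + a) (by omega)
  have hB0 := h1.nonneg (B + b) (by omega)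
  have hd2 := h1.le_two (dst + i) (by omega)
  have hset := h1.setNode (d := dst + i) (by omega) (by omega) (h4 _ (by omega))
    (show A + a < dst by omega) (show B + b < dst by omega) hlt'
  rw [hFA.1, hFB.1] at hset
  refine ⟨_, hset, fun d hd => ?_, ?_, h4, fun i' hi' hlt2 => ?_, fun a' ha' b' hb' hab => ?_⟩
  · rw [Function.update_of_ne (by omega), Function.update_of_ne (by omega)]
    exact h2 d hd
  · refine ⟨fun d hd hdD => ?_, fun d hd => ?_, fun d hd => ?_, h3.item⟩ <;>
      rw [Function.update_of_ne (by omega)]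
    exacts [h3.size d hd hdD, h3.left d hd, h3.right d hd]
  · by_cases hii : i' = i
    · subst hii
      rw [Function.update_self, value_add, hFA.2, hFB.2]
      have := hSA a ha (by linarith [hFA.1, hFB.1])
      have := hSB b hb (by linarith [hFA.1, hFB.1])
      linarith
    · rw [Function.update_of_ne (by omega)] at hlt2 ⊢
      exact h5 i' hi' hlt2
  · by_cases hc : a' = a ∧ b' = b
    · obtain ⟨rfl, rfl⟩ := hc
      rw [hidx, Function.update_self]
    · have h8 := h6 a' ha' b' hb' (by omega)
      rcases eq_or_ne (dst + min m ((a' + b') / c)) (dst + i) with h | h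
      · rw [h] at h8 ⊢
        rw [Function.update_self]
        linarith
      · rwa [Function.update_of_ne h]

/-- The state of the table of single items at `base`, after `q` buckets. -/
def ItemInv (I : UKP) (D base m : ℕ) (u : ℝ) (Rb : ℕ → ℝ) (F₀ : ℕ → ℝ)
    (X₀ : ℕ → Fin I.n → ℕ) (q : ℕ) (F L R J : ℕ → ℝ) : Prop :=
  ∃ X, Dag I D base F L R J X ∧ (∀ d < base, F d = F₀ d ∧ X d = X₀ d) ∧
    Fresh D (base + (m + 1)) F L R J ∧ F base = 0 ∧ Sound I base m u F X ∧
    ∀ q' < q, ∀ j : Fin I.n, Rb q' = (j : ℕ) + 1 →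
      F (base + min m ⌊I.profit j / u⌋₊) ≤ I.size j

theorem ItemInv.init {D base m : ℕ} {u : ℝ} {Rb F L R J : ℕ → ℝ} {X : ℕ → Fin I.n → ℕ}
    (h : Dag I D base F L R J X) (hf : Fresh D base F L R J) (hD : base + m < D) :
    ItemInv I D base m u Rb F X 0 (Function.update F base 0) L R J := by
  have hX := h.eq_zero_of_fresh hf le_rfl (by omega)
  refine ⟨X, h.setEmpty hX, fun d hd => ⟨Function.update_of_ne (by omega) _ _, rfl⟩, ?_, by simp,
    fun i hi hlt => ?_, by omega⟩
  · refine ⟨fun d hd hdD => ?_, (hf.mono (by omega)).left, (hf.mono (by omega)).right,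
      (hf.mono (by omega)).item⟩
    rw [Function.update_of_ne (by omega)]
    exact hf.size d (by omega) hdD
  · rcases Nat.eq_zero_or_pos i with rfl | hi0
    · simpa using I.value_nonneg _
    · rw [Function.update_of_ne (by omega), hf.size _ (by omega) (by omega)] at hlt
      exact absurd hlt (lt_irrefl _)

theorem ItemInv.keep {D base m : ℕ} {u : ℝ} {Rb F₀ : ℕ → ℝ} {X₀ : ℕ → Fin I.n → ℕ} {q : ℕ}
    {F L R J : ℕ → ℝ} (h : ItemInv I D base m u Rb F₀ X₀ q F L R J)
    (hle : ∀ j : Fin I.n, Rb q = (j : ℕ) + 1 →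
      F (base + min m ⌊I.profit j / u⌋₊) ≤ I.size j) :
    ItemInv I D base m u Rb F₀ X₀ (q + 1) F L R J := by
  obtain ⟨X, h1, h2, h3, h4, h5, h6⟩ := h
  refine ⟨X, h1, h2, h3, h4, h5, fun q' hq' j hj => ?_⟩
  rcases Nat.lt_succ_iff_lt_or_eq.mp hq' with hlt | rfl
  · exact h6 q' hlt j hj
  · exact hle j hj

theorem ItemInv.set {D base m : ℕ} {u : ℝ} {Rb F₀ : ℕ → ℝ} {X₀ : ℕ → Fin I.n → ℕ} {q : ℕ}
    {F L R J : ℕ → ℝ} (hu : 0 < u) (hbase : 0 < base)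
    (h : ItemInv I D base m u Rb F₀ X₀ q F L R J) (j : Fin I.n) (hj : Rb q = (j : ℕ) + 1)
    (hlt : I.size j < F (base + min m ⌊I.profit j / u⌋₊)) :
    ItemInv I D base m u Rb F₀ X₀ (q + 1)
      (Function.update F (base + min m ⌊I.profit j / u⌋₊) (I.size j)) L R
      (Function.update J (base + min m ⌊I.profit j / u⌋₊) ((j : ℕ) + 1)) := by
  obtain ⟨X, h1, h2, h3, h4, h5, h6⟩ := h
  have hs := I.size_mem j
  have hi : min m ⌊I.profit j / u⌋₊ ≤ m := min_le_left _ _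
  have hval : (min m ⌊I.profit j / u⌋₊ : ℕ) * u ≤ I.profit j := by
    have hp : 0 ≤ I.profit j / u := div_nonneg (I.profit_mem j).1.le hu.le
    rw [← le_div_iff₀ hu]
    exact (Nat.cast_le.mpr (min_le_right _ _)).trans (Nat.floor_le hp)
  generalize hidx : min m ⌊I.profit j / u⌋₊ = i at *
  -- Entry 0 stands for the empty packing and is never replaced: its size 0 is below that of any
  -- item.
  have hi0 : i ≠ 0 := by
    rintro rfl
    rw [add_zero, h4] at hlt
    linarith [hs.1]
  refine ⟨_, h1.setItem hbase (show base ≤ base + i by omega) j, fun d hd => ?_, ?_, ?_,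
    fun i' hi' hlt2 => ?_, fun q' hq' j' hj' => ?_⟩
  · rw [Function.update_of_ne (by omega), Function.update_of_ne (by omega)]
    exact h2 d hd
  · refine ⟨fun d hd hdD => ?_, h3.left, h3.right, fun d hd => ?_⟩ <;>
      rw [Function.update_of_ne (by omega)]
    exacts [h3.size d hd hdD, h3.item d hd]
  · rwa [Function.update_of_ne (by omega)]
  · by_cases hii : i' = i
    · subst hii
      simpa [value_single] using hval
    · rw [Function.update_of_ne (by omega)] at hlt2 ⊢
      exact h5 i' hi' hlt2
  · rcases Nat.lt_succ_iff_lt_or_eq.mp hq' with hlt3 | rfl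
    · have h8 := h6 q' hlt3 j' hj'
      rcases eq_or_ne (base + min m ⌊I.profit j' / u⌋₊) (base + i) with h | h
      · rw [h] at h8 ⊢
        rw [Function.update_self]
        linarith
      · rwa [Function.update_of_ne h]
    · rw [hj] at hj'
      have : (j : ℕ) = j' := by exact_mod_cast add_right_cancel hj'
      obtain rfl : j = j' := Fin.ext this
      rw [hidx, Function.update_self]

/-! ### One item per profit class, and one small item. -/

/-- The bucket table `Rb` holds items of profit above `T`; the items before `t` are dominated by
the item in their bucket. -/
structure Buckets (I : UKP) (T : ℝ) (m t : ℕ) (Rb : ℕ → ℝ) : Prop where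
  mem : ∀ q, Rb q = 0 ∨ ∃ j : Fin I.n, Rb q = (j : ℕ) + 1 ∧ T < I.profit j ∧
    bucket m T (I.profit j) = q
  le : ∀ j : Fin I.n, j < t → T < I.profit j → ∃ j' : Fin I.n,
    Rb (bucket m T (I.profit j)) = (j' : ℕ) + 1 ∧ I.size j' ≤ I.size j

theorem Buckets.keep_small {T : ℝ} {m t : ℕ} {Rb : ℕ → ℝ} (h : Buckets I T m t Rb)
    (ht : t < I.n) (hle : I.profit ⟨t, ht⟩ ≤ T) : Buckets I T m (t + 1) Rb := by
  refine ⟨h.mem, fun j hj hT => ?_⟩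
  rcases Nat.lt_succ_iff_lt_or_eq.mp hj with hlt | rfl
  · exact h.le j hlt hT
  · exact absurd hT (not_lt.mpr hle)

theorem Buckets.keep_large {T : ℝ} {m t : ℕ} {Rb : ℕ → ℝ} (h : Buckets I T m t Rb)
    (ht : t < I.n) (j' : Fin I.n) (hj' : Rb (bucket m T (I.profit ⟨t, ht⟩)) = (j' : ℕ) + 1)
    (hle : I.size j' ≤ I.size ⟨t, ht⟩) : Buckets I T m (t + 1) Rb := by
  refine ⟨h.mem, fun j hj hT => ?_⟩
  rcases Nat.lt_succ_iff_lt_or_eq.mp hj with hlt | rfl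
  · exact h.le j hlt hT
  · exact ⟨j', hj', hle⟩

theorem Buckets.set {T : ℝ} {m t : ℕ} {Rb : ℕ → ℝ} (h : Buckets I T m t Rb)
    (ht : t < I.n) (hT : T < I.profit ⟨t, ht⟩)
    (hlt : ∀ j' : Fin I.n, Rb (bucket m T (I.profit ⟨t, ht⟩)) = (j' : ℕ) + 1 →
      I.size ⟨t, ht⟩ ≤ I.size j') :
    Buckets I T m (t + 1)
      (Function.update Rb (bucket m T (I.profit ⟨t, ht⟩)) ((t : ℝ) + 1)) := by
  refine ⟨fun q => ?_, fun j hj hjT => ?_⟩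
  · by_cases hq : q = bucket m T (I.profit ⟨t, ht⟩)
    · subst hq
      exact Or.inr ⟨⟨t, ht⟩, by simp, hT, rfl⟩
    · rw [Function.update_of_ne hq]
      exact h.mem q
  · by_cases hq : bucket m T (I.profit j) = bucket m T (I.profit ⟨t, ht⟩)
    · rw [hq, Function.update_self]
      refine ⟨⟨t, ht⟩, rfl, ?_⟩
      rcases Nat.lt_succ_iff_lt_or_eq.mp hj with hlt' | rfl
      · obtain ⟨j', hj', hle⟩ := h.le j hlt' hjT
        rw [hq] at hj'
        exact (hlt j' hj').trans hle
      · exact le_rfl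
    · rw [Function.update_of_ne hq]
      rcases Nat.lt_succ_iff_lt_or_eq.mp hj with hlt' | rfl
      · exact h.le j hlt' hjT
      · exact absurd rfl hq

/-- The item `b` of profit `pb` and size `sb` is the most efficient one among those before `t`
whose profit is at most `T`.  If there is none, a profit `0` and a size `2` are pretended. -/
def BestSmall (I : UKP) (T : ℝ) (t : ℕ) (pb sb b : ℝ) : Prop :=
  (∃ j : Fin I.n, b = (j : ℕ) ∧
    ((pb = I.profit j ∧ sb = I.size j ∧ I.profit j ≤ T) ∨ (pb = 0 ∧ sb = 2))) ∧
  ∀ j : Fin I.n, j < t → I.profit j ≤ T → I.profit j * sb ≤ pb * I.size j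

theorem BestSmall.size_pos {T : ℝ} {t : ℕ} {pb sb b : ℝ} (h : BestSmall I T t pb sb b) :
    0 < sb := by
  obtain ⟨⟨j, -, ⟨-, rfl, -⟩ | ⟨-, rfl⟩⟩, -⟩ := h
  · exact (I.size_mem j).1
  · norm_num

theorem BestSmall.init {T : ℝ} (hn : 0 < I.n) : BestSmall I T 0 0 2 0 :=
  ⟨⟨⟨0, hn⟩, by simp, Or.inr ⟨rfl, rfl⟩⟩, fun j hj => absurd hj (Nat.not_lt_zero _)⟩

theorem BestSmall.keep_large {T : ℝ} {t : ℕ} {pb sb b : ℝ} (h : BestSmall I T t pb sb b)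
    (ht : t < I.n) (hT : T < I.profit ⟨t, ht⟩) : BestSmall I T (t + 1) pb sb b := by
  refine ⟨h.1, fun j hj hjT => ?_⟩
  rcases Nat.lt_succ_iff_lt_or_eq.mp hj with hlt' | rfl
  · exact h.2 j hlt' hjT
  · exact absurd hT (not_lt.mpr hjT)

theorem BestSmall.keep_small {T : ℝ} {t : ℕ} {pb sb b : ℝ} (h : BestSmall I T t pb sb b)
    (ht : t < I.n) (hle : I.profit ⟨t, ht⟩ * sb ≤ pb * I.size ⟨t, ht⟩) :
    BestSmall I T (t + 1) pb sb b := by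
  refine ⟨h.1, fun j hj hjT => ?_⟩
  rcases Nat.lt_succ_iff_lt_or_eq.mp hj with hlt' | rfl
  · exact h.2 j hlt' hjT
  · exact hle

theorem BestSmall.set {T : ℝ} {t : ℕ} {pb sb b : ℝ} (h : BestSmall I T t pb sb b)
    (ht : t < I.n) (hT : I.profit ⟨t, ht⟩ ≤ T)
    (hlt : pb * I.size ⟨t, ht⟩ < I.profit ⟨t, ht⟩ * sb) :
    BestSmall I T (t + 1) (I.profit ⟨t, ht⟩) (I.size ⟨t, ht⟩) t := by
  refine ⟨⟨⟨t, ht⟩, rfl, Or.inl ⟨rfl, rfl, hT⟩⟩, fun j hj hjT => ?_⟩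
  rcases Nat.lt_succ_iff_lt_or_eq.mp hj with hlt' | rfl
  · have h1 := h.2 j hlt' hjT
    have hsb := h.size_pos
    have h2 := mul_le_mul_of_nonneg_right h1 (I.size_mem ⟨t, ht⟩).1.le
    have h3 := mul_le_mul_of_nonneg_right hlt.le (I.size_mem j).1.le
    refine le_of_mul_le_mul_right ?_ hsb
    linarith
  · exact le_rfl

/-- Two units are lost: replacing an item by the representative of its class costs at most p/m ≤ u,
as p ≤ m·u, and rounding the profit down to a multiple of u costs another one. -/
theorem ItemInv.complete {D base m M : ℕ} {T u : ℝ} {Rb F₀ : ℕ → ℝ} {X₀ : ℕ → Fin I.n → ℕ}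
    {F L R J : ℕ → ℝ} (hm : 0 < m) (hT : 0 < T) (hu : 0 < u)
    (h : ItemInv I D base m u Rb F₀ X₀ M F L R J) (hRb : Buckets I T m I.n Rb)
    (hM : ∀ j, T < I.profit j → bucket m T (I.profit j) < M) :
    I.ItemComplete T m u fun i => F (base + i) := by
  obtain ⟨X, h1, h2, h3, h4, h5, h6⟩ := h
  refine ⟨by simp [h4], fun j hj hjm => ?_⟩
  obtain ⟨j', hj', hs⟩ := hRb.le j j.2 hj
  have h7 := h6 _ (hM j hj) j' hj'
  refine ⟨_, min_le_left _ _, ?_, h7.trans hs⟩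
  rcases hRb.mem (bucket m T (I.profit j)) with h0 | ⟨j'', hj'', hT', hb⟩
  · rw [h0] at hj'
    have : (0 : ℝ) ≤ (j' : ℕ) := Nat.cast_nonneg _
    linarith
  rw [hj'] at hj''
  have : (j' : ℕ) = j'' := by exact_mod_cast add_right_cancel hj''
  obtain rfl : j' = j'' := Fin.ext this
  have hle := mul_le_of_bucket_eq hm hT hj hT' hb.symm
  have hm' : (0 : ℝ) < m := by exact_mod_cast hm
  have hdiv : I.profit j * (1 / m) ≤ u := by
    rw [mul_one_div, div_le_iff₀ hm']
    linarith
  have hfl := Nat.lt_floor_add_one (I.profit j' / u)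
  rw [div_lt_iff₀ hu] at hfl
  rcases le_total m ⌊I.profit j' / u⌋₊ with hc | hc
  · rw [min_eq_left hc]
    linarith
  · rw [min_eq_right hc]
    linarith

/-! ### Recovering a packing from the graph. -/

/-- The state of the unfolding of the packing `target`: the packings of the cells below `e`
still have to be added to the output, as often as `cnt` says. -/
def BackInv (I : UKP) (X : ℕ → Fin I.n → ℕ) (target : Fin I.n → ℕ) (e : ℕ) (cnt x : ℕ → ℝ) :
    Prop :=
  ∃ (c : ℕ → ℕ) (y : Fin I.n → ℕ), (∀ d, cnt d = c d) ∧ (∀ j : Fin I.n, x j = y j) ∧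
    y + ∑ d ∈ Finset.range e, c d • X d = target

theorem BackInv.init {X : ℕ → Fin I.n → ℕ} {D d : ℕ} {cnt x : ℕ → ℝ} (hd : d < D)
    (hcnt : ∀ d, cnt d = 0) (hx : ∀ j, x j = 0) :
    BackInv I X (X d) D (Function.update cnt d 1) x := by
  refine ⟨Pi.single d 1, 0, fun e => ?_, fun j => by simp [hx], ?_⟩
  · by_cases he : e = d
    · subst he
      simp
    · simp [he, hcnt]
  · rw [zero_add, Finset.sum_eq_single d]
    · simp
    · intro e _ he
      simp [he]
    · simp [hd]

theorem BackInv.item {X : ℕ → Fin I.n → ℕ} {target : Fin I.n → ℕ} {e : ℕ} {cnt x : ℕ → ℝ}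
    (h : BackInv I X target (e + 1) cnt x) (j : Fin I.n) (hj : X e = Pi.single j 1) :
    BackInv I X target e cnt (Function.update x j (x j + cnt e)) := by
  obtain ⟨c, y, hc, hy, hsum⟩ := h
  refine ⟨c, y + c e • X e, hc, fun i => ?_, ?_⟩
  · by_cases hij : i = j
    · subst hij
      simp [hc, hy, hj]
    · have : (i : ℕ) ≠ j := fun h => hij (Fin.ext h)
      simp [this, hij, hy, hj]
  · rw [← hsum, Finset.sum_range_succ]
    abel

/-- The multiplicity of `e` passes to both of its parts, which come later in the downward sweep. The
second counter is read after the first has been written, so a cell that is combined with itself is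
counted twice. -/
theorem BackInv.node {X : ℕ → Fin I.n → ℕ} {target : Fin I.n → ℕ} {e a b : ℕ}
    {cnt x : ℕ → ℝ} (h : BackInv I X target (e + 1) cnt x) (hX : X e = X a + X b)
    (ha : a < e) (hb : b < e) :
    BackInv I X target e
      (Function.update (Function.update cnt a (cnt a + cnt e)) b
        ((Function.update cnt a (cnt a + cnt e)) b + cnt e)) x := by
  obtain ⟨c, y, hc, hy, hsum⟩ := h
  refine ⟨fun d => c d + (if d = a then c e else 0) + (if d = b then c e else 0), y,
    fun d => ?_, hy, ?_⟩
  · simp only [Function.update_apply]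
    split_ifs <;> simp_all
  · rw [← hsum, Finset.sum_range_succ, hX]
    simp only [add_smul, Finset.sum_add_distrib, ite_smul, zero_smul, Finset.sum_ite_eq',
      Finset.mem_range, ha, hb, if_true, smul_add]
    abel

theorem BackInv.done {X : ℕ → Fin I.n → ℕ} {target : Fin I.n → ℕ} {cnt x : ℕ → ℝ}
    (h : BackInv I X target 1 cnt x) (hX : X 0 = 0) (j : Fin I.n) : x j = target j := by
  obtain ⟨c, y, hc, hy, hsum⟩ := h
  rw [hy, ← hsum]
  simp [hX]

/-! ### Completing a table entry by small items. -/

/-- The best table entry, completed by copies of the most efficient small item, is almost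
optimal. -/
theorem exists_good_cell {T P u pb sb b : ℝ} {m K : ℕ} {G : ℕ → ℝ} (hT : 0 ≤ T)
    (hG : I.Complete T m K u G) (hP : m * u = 2 * P)
    (hOPT : ∀ x, I.weight x ≤ 1 → I.value x ≤ 2 * P) (hb : BestSmall I T I.n pb sb b) :
    ∃ i ≤ m, G i ≤ 1 ∧
      I.OPT - 3 * K * u - T ≤ i * u + pb * ((⌊(1 - G i) / sb⌋ : ℤ) : ℝ) := by
  obtain ⟨x, hx, hval⟩ := I.isGreatest_OPT.1
  change I.weight x ≤ 1 at hx
  -- An optimal packing is split into its large items `y`, approximated by the table, and its small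
  -- items `z`.
  set y : Fin I.n → ℕ := fun j => if I.profit j ≤ T then 0 else x j with hy
  set z : Fin I.n → ℕ := fun j => if I.profit j ≤ T then x j else 0 with hz
  have hxyz : x = y + z := by
    funext j
    simp only [hy, hz, Pi.add_apply]
    split_ifs <;> simp
  have hv : I.OPT = I.value y + I.value z := by rw [hval, hxyz, value_add]
  have hw : I.weight y + I.weight z ≤ 1 := by rwa [hxyz, weight_add] at hx
  have hVx := hOPT x hx
  obtain ⟨i, him, hi, hGi⟩ := hG y (fun j hj => if_pos hj) (by
    have := I.value_nonneg z
    linarith)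
  have hwz := I.weight_nonneg z
  refine ⟨i, him, by linarith, ?_⟩
  have hsb := hb.size_pos
  have h1 : I.value z * sb ≤ pb * I.weight z := by
    rw [value, weight, Finset.sum_mul, Finset.mul_sum]
    refine Finset.sum_le_sum fun j _ => ?_
    by_cases hj : I.profit j ≤ T
    · have := mul_le_mul_of_nonneg_right (hb.2 j j.2 hj) (Nat.cast_nonneg (α := ℝ) (z j))
      linarith
    · simp [hz, hj]
  have hpb : 0 ≤ pb ∧ pb ≤ T := by
    obtain ⟨⟨j, -, ⟨rfl, -, h⟩ | ⟨rfl, -⟩⟩, -⟩ := hb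
    · exact ⟨(I.profit_mem j).1.le, h⟩
    · exact ⟨le_rfl, hT⟩
  have h2 : pb * I.weight z ≤ pb * (1 - G i) :=
    mul_le_mul_of_nonneg_left (by linarith) hpb.1
  have h3 : I.value z ≤ pb * ((1 - G i) / sb) := by
    rw [← mul_div_assoc, le_div_iff₀ hsb]
    linarith
  -- Rounding the fractional number of copies down costs at most one copy, of profit pb ≤ T.
  have h4 := mul_le_mul_of_nonneg_left (Int.lt_floor_add_one ((1 - G i) / sb)).le hpb.1
  linarith

theorem BestSmall.fill {T pb sb b : ℝ} (h : BestSmall I T I.n pb sb b) {x : Fin I.n → ℕ}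
    (hx : I.weight x ≤ 1) :
    ∃ (j : Fin I.n) (k : ℕ), b = (j : ℕ) ∧ ((⌊(1 - I.weight x) / sb⌋ : ℤ) : ℝ) = k ∧
      I.weight (x + Pi.single j k) ≤ 1 ∧
      I.value x + pb * k ≤ I.value (x + Pi.single j k) := by
  have hsb := h.size_pos
  have h0 : 0 ≤ (1 - I.weight x) / sb := div_nonneg (by linarith) hsb.le
  obtain ⟨⟨j, hb, hj⟩, -⟩ := h
  refine ⟨j, ⌊(1 - I.weight x) / sb⌋₊, hb, (natCast_floor_eq_intCast_floor h0).symm, ?_⟩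
  rcases hj with ⟨rfl, rfl, -⟩ | ⟨rfl, rfl⟩
  · rw [weight_add, weight_single, value_add, value_single]
    have := Nat.floor_le h0
    rw [le_div_iff₀ hsb] at this
    exact ⟨by linarith, le_rfl⟩
  -- Without small items, the pretended size 2 exceeds the capacity, so no copy is added.
  · have : ⌊(1 - I.weight x) / 2⌋₊ = 0 := by
      rw [Nat.floor_eq_zero]
      linarith [I.weight_nonneg x]
    rw [this]
    simpa using hx

/-- The state of the tables after `k` levels. -/
def LevelInv (I : UKP) (D m : ℕ) (T u : ℝ) (k : ℕ) (F L R J : ℕ → ℝ) : Prop :=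
  ∃ X, Dag I D ((3 * k + 1) * (m + 1)) F L R J X ∧ Fresh D ((3 * k + 1) * (m + 1)) F L R J ∧
    Sound I (3 * k * (m + 1)) m (2 ^ k * u) F X ∧
    I.Complete T m k (2 ^ k * u) fun i => F (3 * k * (m + 1) + i)

theorem LevelInv.zero {D m : ℕ} {T u : ℝ} {F : ℕ → ℝ} (hF : ∀ d < D, F d = 2)
    (hD : m + 1 ≤ D) (hu : m * u ≤ T) :
    LevelInv I D m T u 0 (Function.update F 0 0) (fun _ => 0) (fun _ => 0) (fun _ => 0) := by
  have hdag : Dag I D 1 F (fun _ => 0) (fun _ => 0) (fun _ => 0) (fun _ => 0) := by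
    refine ⟨rfl, fun d hd hlt => ?_, fun d hd => ?_, fun d hd => ?_, fun d hd => ?_⟩
    · rw [hF d hd] at hlt
      exact absurd hlt (lt_irrefl _)
    · rw [hF d hd]
      norm_num
    · rw [hF d hd]
    · exact Or.inr ⟨rfl, 0, 0, by simp, by simp, by omega, by omega, by omega, by omega, by simp⟩
  refine ⟨_, (hdag.setEmpty (d := 0) rfl).mono (by omega), ?_, ?_, ?_⟩
  · refine ⟨fun d hd hdD => ?_, fun _ _ => rfl, fun _ _ => rfl, fun _ _ => rfl⟩
    rw [Function.update_of_ne (by omega), hF d hdD]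
  · intro i hi hlt
    rcases Nat.eq_zero_or_pos i with rfl | hi0
    · simp
    · rw [Function.update_of_ne (by omega), hF _ (by omega)] at hlt
      exact absurd hlt (lt_irrefl _)
  · rw [pow_zero, one_mul]
    exact Complete.zero I hu (by simp)

end UKP

/-! ### The program: combining tables and computing the levels. -/

namespace RealRAM

open UKP

local notation "rEps" => (0 : Fin 37)
local notation "rN" => (1 : Fin 37)
local notation "rE" => (2 : Fin 37)
local notation "rK" => (3 : Fin 37)
local notation "rM" => (4 : Fin 37)
local notation "rM1" => (5 : Fin 37)
local notation "rH" => (6 : Fin 37)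
local notation "rP" => (7 : Fin 37)
local notation "rT" => (8 : Fin 37)
local notation "rMK" => (9 : Fin 37)
local notation "rD" => (10 : Fin 37)
local notation "rPb" => (11 : Fin 37)
local notation "rSb" => (12 : Fin 37)
local notation "rB" => (13 : Fin 37)
local notation "rU" => (14 : Fin 37)
local notation "rJ" => (15 : Fin 37)
local notation "rI" => (16 : Fin 37)
local notation "rL" => (17 : Fin 37)
local notation "rp" => (18 : Fin 37)
local notation "rs" => (19 : Fin 37)
local notation "rIdx" => (20 : Fin 37)
local notation "rr" => (21 : Fin 37)
local notation "rf" => (22 : Fin 37)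
local notation "rBase" => (23 : Fin 37)
local notation "rItem" => (24 : Fin 37)
local notation "rDst" => (25 : Fin 37)
local notation "rFa" => (26 : Fin 37)
local notation "rFb" => (27 : Fin 37)
local notation "rBest" => (28 : Fin 37)
local notation "rArg" => (29 : Fin 37)
local notation "rFill" => (30 : Fin 37)
local notation "rC" => (31 : Fin 37)
local notation "rA1" => (32 : Fin 37)
local notation "rA2" => (33 : Fin 37)
local notation "rD1" => (34 : Fin 37)
local notation "rd" => (35 : Fin 37)
local notation "rv" => (36 : Fin 37)
local notation "aP" => (0 : Fin 9)
local notation "aS" => (1 : Fin 9)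
local notation "aX" => (2 : Fin 9)
local notation "aB" => (3 : Fin 9)
local notation "aF" => (4 : Fin 9)
local notation "aL" => (5 : Fin 9)
local notation "aR" => (6 : Fin 9)
local notation "aJ" => (7 : Fin 9)
local notation "aC" => (8 : Fin 9)

/-- Replace the contents of the register `i` by the minimum with the contents of `j`. -/
def clamp {r a : ℕ} (i j : Fin r) : Prog r a :=
  .branch (.lt (.reg j) (.reg i)) (.assign i (.reg j)) .skip

theorem wp_clamp {r a S : ℕ} {i j : Fin r} {Q : State r a → Prop} {σ : State r a} :
    wp S (clamp i j) Q σ ↔ Q ⟨Function.update σ.reg i (min (σ.reg j) (σ.reg i)), σ.arr⟩ := by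
  simp only [clamp, wp, Test.Holds, Expr.eval]
  rcases lt_or_ge (σ.reg j) (σ.reg i) with h | h
  · simp [h, min_eq_left h.le]
  · simp [not_lt.mpr h, min_eq_right h]

/-- Combine an entry of the table at `rA1` with an entry of the table at `rA2`. -/
def convStep (c : ℕ) : Prog 37 9 :=
  .seq (.load rFb aF (.add (.reg rA2) (.reg rI))) <|
  .seq (.assign rIdx (.floor (.div (.add (.reg rJ) (.reg rI)) (.lit c)))) <|
  .seq (clamp rIdx rM) <|
  .seq (.load rf aF (.add (.reg rDst) (.reg rIdx))) <|
  .branch (.lt (.add (.reg rFa) (.reg rFb)) (.reg rf))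
    (.seq (.store aF (.add (.reg rDst) (.reg rIdx)) (.add (.reg rFa) (.reg rFb))) <|
      .seq (.store aL (.add (.reg rDst) (.reg rIdx)) (.add (.reg rA1) (.reg rJ)))
        (.store aR (.add (.reg rDst) (.reg rIdx)) (.add (.reg rA2) (.reg rI))))
    .skip

/-- Combine the tables at `rA1` and `rA2` into the table at `rDst`, whose unit is `c` times as
large. -/
def conv (c : ℕ) : Prog 37 9 :=
  forLoop rJ rM1 <| .seq (.load rFa aF (.add (.reg rA1) (.reg rJ))) <| forLoop rI rM1 <| convStep c

theorem floor_natCast_add_div (a b c : ℕ) :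
    ((⌊((a : ℝ) + b) / c⌋ : ℤ) : ℝ) = ((a + b) / c : ℕ) := by
  rw [← natCast_floor_eq_intCast_floor (by positivity), ← Nat.cast_add, Nat.floor_div_eq_div]

theorem runs_conv {I : UKP} {S D dst m c A B : ℕ} {u : ℝ} {X : ℕ → Fin I.n → ℕ}
    {σ : State 37 9} (hm : σ.reg rM = m) (hm1 : σ.reg rM1 = (m + 1 : ℕ)) (hA : σ.reg rA1 = A)
    (hB : σ.reg rA2 = B) (hdst : σ.reg rDst = dst) (hD : dst + m < D) (hS : D ≤ S)
    (hAd : A + m < dst) (hBd : B + m < dst) (hu : 0 ≤ u)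
    (h : Dag I D dst (σ.arr aF) (σ.arr aL) (σ.arr aR) (σ.arr aJ) X)
    (hf : Fresh D dst (σ.arr aF) (σ.arr aL) (σ.arr aR) (σ.arr aJ))
    (hSA : Sound I A m u (σ.arr aF) X) (hSB : Sound I B m u (σ.arr aF) X) :
    Runs S (conv c) σ ((m + 1) * ((4 + ((m + 1) * (60 + 7) + 5)) + 7) + 5) fun τ =>
      ConvInv I D dst m c A B u (σ.arr aF) X (m + 1) 0
        (τ.arr aF) (τ.arr aL) (τ.arr aR) (τ.arr aJ) := by
  refine runs_forLoop (fun a τ => ConvInv I D dst m c A B u (σ.arr aF) X a 0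
        (τ.arr aF) (τ.arr aL) (τ.arr aR) (τ.arr aJ)) hm1 (by decide) rfl rfl
    (ConvInv.init h hf hD) ?_
  intro a ha τ hτ hfr hinv
  refine Runs.seq (Q := fun υ => υ.arr = τ.arr ∧ υ.reg rFa = σ.arr aF (A + a)) ?_ ?_
  · refine runs_of_wp ?_ (le_refl 4)
    refine ⟨A + a, ?_, by omega, rfl, ?_⟩
    · simp only [Expr.eval, hτ, hfr.reg rA1 rfl, hA]
      push_cast
      rfl
    · obtain ⟨X', -, h2, -⟩ := hinv
      simp [(h2 (A + a) (by omega)).1]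
  rintro υ hυ ⟨harr, hfa⟩
  have hmυ : υ.reg rM1 = (m + 1 : ℕ) := by rw [hυ.reg rM1 rfl, hfr.reg rM1 rfl, hm1]
  refine Runs.mono (runs_forLoop (fun b τ => ConvInv I D dst m c A B u (σ.arr aF) X a b
        (τ.arr aF) (τ.arr aL) (τ.arr aR) (τ.arr aJ)) (t := 60) hmυ (by decide) rfl rfl
    (by simpa only [harr] using hinv) ?_) le_rfl (fun ω _ hω => hω.next)
  intro b hb ω hω hfr' hinv'
  refine runs_of_wp ?_ (Nat.le_of_ble_eq_true rfl)
  have e1 : ω.reg rA1 = A := by rw [hfr'.reg rA1 rfl, hυ.reg rA1 rfl, hfr.reg rA1 rfl, hA]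
  have e2 : ω.reg rA2 = B := by rw [hfr'.reg rA2 rfl, hυ.reg rA2 rfl, hfr.reg rA2 rfl, hB]
  have e3 : ω.reg rDst = dst := by rw [hfr'.reg rDst rfl, hυ.reg rDst rfl, hfr.reg rDst rfl, hdst]
  have e4 : ω.reg rM = m := by rw [hfr'.reg rM rfl, hυ.reg rM rfl, hfr.reg rM rfl, hm]
  have e5 : ω.reg rJ = a := by rw [hfr'.reg rJ rfl, hυ.reg rJ rfl, hτ]
  have e6 : ω.reg rFa = σ.arr aF (A + a) := by rw [hfr'.reg rFa rfl, hfa]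
  -- The source tables lie below `dst` and are not modified while the new table is filled.
  have hFB : ω.arr aF (B + b) = σ.arr aF (B + b) := by
    obtain ⟨X', -, h2, -⟩ := hinv'
    exact (h2 (B + b) (by omega)).1
  have hidx : (dst : ℝ) + min (m : ℝ) ((⌊((a : ℝ) + b) / c⌋ : ℤ) : ℝ) =
      (dst + min m ((a + b) / c) : ℕ) := by
    rw [floor_natCast_add_div]
    push_cast
    rfl
  have hlt : dst + min m ((a + b) / c) < S := by
    have := min_le_left m ((a + b) / c)
    omega
  simp only [convStep, wp, wp_clamp, Expr.eval, Test.Holds]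
  refine ⟨B + b, by rw [e2, hω]; push_cast; rfl, by omega, ?_⟩
  simp [e1, e2, e3, e4, e5, e6, hω, hFB, -Nat.cast_min, -Nat.cast_add]
  refine ⟨_, hidx, hlt, fun h => ?_, fun h => ?_⟩
  · refine ⟨_, hidx, hlt, _, hidx, hlt, _, hidx, hlt, ?_⟩
    have := hinv'.set hu (by omega) (by omega) hAd hBd hD hSA hSB h
    push_cast at this
    exact this
  · exact hinv'.keep h
/-- Enter the item of bucket `rJ` into the table of single items. -/
def itemStep : Prog 37 9 :=
  .seq (.load rr aB (.reg rJ)) <|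
  .branch (.lt (.lit 0) (.reg rr))
    (.seq (.load rp aP (.sub (.reg rr) (.lit 1))) <|
      .seq (.load rs aS (.sub (.reg rr) (.lit 1))) <|
      .seq (.assign rIdx (.floor (.div (.reg rp) (.reg rU)))) <|
      .seq (clamp rIdx rM) <|
      .seq (.load rf aF (.add (.reg rItem) (.reg rIdx))) <|
      .branch (.lt (.reg rs) (.reg rf))
        (.seq (.store aF (.add (.reg rItem) (.reg rIdx)) (.reg rs))
          (.store aJ (.add (.reg rItem) (.reg rIdx)) (.reg rr)))
        .skip)
    .skip

/-- Fill the table of single items at `rItem`. -/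
def itemTable : Prog 37 9 :=
  .seq (.store aF (.reg rItem) (.lit 0)) (forLoop rJ rMK itemStep)

/-- The first two arrays hold the profits and sizes of the instance. -/
def Holds (I : UKP) (σ : State 37 9) : Prop :=
  ∀ j : Fin I.n, σ.arr aP j = I.profit j ∧ σ.arr aS j = I.size j

theorem Holds.of_frame {I : UKP} {σ τ : State 37 9} {P : Prog 37 9} (h : Holds I σ)
    (hf : Frame P σ τ) (hP : P.keepsArr aP = true) (hS : P.keepsArr aS = true) : Holds I τ := by
  intro j
  rw [hf.arr aP hP, hf.arr aS hS]
  exact h j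

theorem runs_itemTable {I : UKP} {S D base m M : ℕ} {T u : ℝ} {X : ℕ → Fin I.n → ℕ}
    {σ : State 37 9} (hI : Holds I σ) (hn : I.n ≤ S) (hM : M ≤ S)
    (hm : σ.reg rM = m) (hMK : σ.reg rMK = M) (hitem : σ.reg rItem = base) (hU : σ.reg rU = u)
    (hD : base + m < D) (hS : D ≤ S) (hbase : 0 < base) (hu : 0 < u)
    (hRb : Buckets I T m I.n (σ.arr aB))
    (h : Dag I D base (σ.arr aF) (σ.arr aL) (σ.arr aR) (σ.arr aJ) X)
    (hf : Fresh D base (σ.arr aF) (σ.arr aL) (σ.arr aR) (σ.arr aJ)) :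
    Runs S itemTable σ (3 + (M * (60 + 7) + 5)) fun τ =>
      ItemInv I D base m u (σ.arr aB) (σ.arr aF) X M
        (τ.arr aF) (τ.arr aL) (τ.arr aR) (τ.arr aJ) := by
  refine Runs.seq (Q := fun υ => υ.arr aF = Function.update (σ.arr aF) base 0) ?_ ?_
  · refine runs_of_wp ?_ (le_refl 3)
    exact ⟨base, by simp [Expr.eval, hitem], by omega, by simp [Expr.eval]⟩
  intro υ hυ hF
  refine runs_forLoop (fun q τ => ItemInv I D base m u (σ.arr aB) (σ.arr aF) X q
    (τ.arr aF) (τ.arr aL) (τ.arr aR) (τ.arr aJ)) (by rw [hυ.reg rMK rfl, hMK]) (by decide) rfl rfl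
    (by
      have := ItemInv.init (Rb := σ.arr aB) (u := u) h hf hD
      rwa [← hF, ← hυ.arr aL rfl, ← hυ.arr aR rfl, ← hυ.arr aJ rfl] at this) ?_
  intro q hq τ hτ hfr hinv
  refine runs_of_wp ?_ (Nat.le_of_ble_eq_true rfl)
  have e1 : τ.reg rM = m := by rw [hfr.reg rM rfl, hυ.reg rM rfl, hm]
  have e2 : τ.reg rItem = base := by rw [hfr.reg rItem rfl, hυ.reg rItem rfl, hitem]
  have e3 : τ.reg rU = u := by rw [hfr.reg rU rfl, hυ.reg rU rfl, hU]
  have e4 : τ.arr aB = σ.arr aB := by rw [hfr.arr aB rfl, hυ.arr aB rfl]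
  have hI' : Holds I τ := (hI.of_frame hυ rfl rfl).of_frame hfr rfl rfl
  simp only [itemStep, wp, wp_clamp, Expr.eval, Test.Holds]
  refine ⟨q, hτ, by omega, ?_⟩
  rcases hRb.mem q with h0 | ⟨j, hj, -, -⟩
  · simp only [e4, h0, Function.update_self, Nat.cast_zero, lt_self_iff_false, false_implies,
      not_false_eq_true, true_implies, true_and]
    refine hinv.keep fun j hj => ?_
    rw [h0] at hj
    have : (0 : ℝ) ≤ (j : ℕ) := Nat.cast_nonneg _
    linarith
  · have hpos : (0 : ℝ) < ((j : ℕ) : ℝ) + 1 := by positivity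
    have hidx : (base : ℝ) + min (m : ℝ) ((⌊I.profit j / u⌋ : ℤ) : ℝ) =
        (base + min m ⌊I.profit j / u⌋₊ : ℕ) := by
      rw [← natCast_floor_eq_intCast_floor (div_nonneg (I.profit_mem j).1.le hu.le)]
      push_cast
      rfl
    have hlt : base + min m ⌊I.profit j / u⌋₊ < S := by
      have := min_le_left m ⌊I.profit j / u⌋₊
      omega
    refine ⟨fun _ => ?_, fun h => absurd (by simpa [e4, hj] using hpos) h⟩
    refine ⟨j, by simp [e4, hj], by omega, j, by simp [e4, hj], by omega, ?_⟩
    simp [e1, e2, e3, e4, hj, (hI' j).1, (hI' j).2, -Nat.cast_min, -Nat.cast_add]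
    refine ⟨_, hidx, hlt, fun h => ?_, fun h => ?_⟩
    · exact ⟨_, hidx, hlt, _, hidx, hlt, hinv.set hu hbase j hj h⟩
    · refine hinv.keep fun j' hj' => ?_
      rw [hj] at hj'
      have : (j : ℕ) = j' := by exact_mod_cast add_right_cancel hj'
      obtain rfl : j = j' := Fin.ext this
      exact h

/-- Compute the tables of the next level. -/
def level : Prog 37 9 :=
  .seq (.assign rU (.mul (.lit 2) (.reg rU))) <|
  .seq (.assign rBase (.mul (.mul (.lit 3) (.reg rL)) (.reg rM1))) <|
  .seq (.assign rItem (.add (.reg rBase) (.reg rM1))) <|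
  .seq itemTable <|
  .seq (.seq (.assign rA1 (.reg rBase)) <| .seq (.assign rA2 (.reg rBase))
    (.assign rDst (.add (.reg rItem) (.reg rM1)))) <|
  .seq (conv 2) <|
  .seq (.seq (.assign rA1 (.reg rDst)) <| .seq (.assign rA2 (.reg rItem))
    (.assign rDst (.add (.reg rDst) (.reg rM1)))) <|
  conv 1

/-- Tables occupy consecutive blocks of m + 1 cells. Level k ends at the block number 3k; the next
three blocks receive the single items, the table combined with itself, and the combination of these
two, which is the table of level k + 1. -/
theorem runs_level {I : UKP} {S D m M k : ℕ} {T u : ℝ} {σ : State 37 9}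
    (hI : Holds I σ) (hn : I.n ≤ S) (hMS : M ≤ S) (hm0 : 0 < m) (hT : 0 < T) (hu : 0 < u)
    (hm : σ.reg rM = m) (hm1 : σ.reg rM1 = (m + 1 : ℕ)) (hMK : σ.reg rMK = M)
    (hL : σ.reg rL = k) (hU : σ.reg rU = 2 ^ k * u)
    (hD : (3 * (k + 1) + 1) * (m + 1) ≤ D) (hS : D ≤ S)
    (hRb : Buckets I T m I.n (σ.arr aB)) (hM : ∀ j, T < I.profit j → bucket m T (I.profit j) < M)
    (h : LevelInv I D m T u k (σ.arr aF) (σ.arr aL) (σ.arr aR) (σ.arr aJ)) :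
    Runs S level σ (200 * ((m + 1) * (m + 1)) + 100 * M + 200) fun τ =>
      τ.reg rU = 2 ^ (k + 1) * u ∧
      LevelInv I D m T u (k + 1) (τ.arr aF) (τ.arr aL) (τ.arr aR) (τ.arr aJ) := by
  obtain ⟨X, hX, hXf, hXs, hXc⟩ := h
  have hb1 : (3 * k + 1) * (m + 1) = 3 * k * (m + 1) + (m + 1) := by ring
  have hb2 : 3 * (k + 1) * (m + 1) = 3 * k * (m + 1) + (m + 1) + (m + 1) + (m + 1) := by ring
  have hb3 : (3 * (k + 1) + 1) * (m + 1) =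
      3 * k * (m + 1) + (m + 1) + (m + 1) + (m + 1) + (m + 1) := by ring
  have hbase : (3 : ℝ) * k * (m + 1 : ℕ) = (3 * k * (m + 1) : ℕ) := by push_cast; ring
  unfold LevelInv
  rw [hb1] at hX hXf
  rw [hb2, hb3]
  rw [hb3] at hD
  generalize 3 * k * (m + 1) = b at *
  have hu' : 0 < 2 ^ k * u := by positivity
  have hu2 : 2 ^ (k + 1) * u = 2 * (2 ^ k * u) := by ring
  rw [hu2]
  generalize 2 ^ k * u = w at *
  refine Runs.mono (t := 4 + (6 + (4 + ((3 + (M * (60 + 7) + 5)) + (8 +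
    (((m + 1) * ((4 + ((m + 1) * (60 + 7) + 5)) + 7) + 5) + (8 +
      ((m + 1) * ((4 + ((m + 1) * (60 + 7) + 5)) + 7) + 5))))))))
    ?_ (by have := Nat.le_mul_self (m + 1); generalize m + 1 = N at *; linarith) (fun _ _ h => h)
  refine Runs.seq (Q := fun υ => υ.arr = σ.arr ∧ υ.reg rU = 2 * w)
    (runs_of_wp (by simp [wp, Expr.eval, hU]) (Nat.le_of_ble_eq_true rfl)) ?_
  rintro σ₁ f₁ ⟨ha₁, hU₁⟩
  refine Runs.seq (Q := fun υ => υ.arr = σ.arr ∧ υ.reg rBase = b)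
    (runs_of_wp (by
      simp only [wp, Expr.eval, f₁.reg rL rfl, f₁.reg rM1 rfl, hL, hm1, Function.update_self]
      exact ⟨ha₁, by exact_mod_cast hbase⟩) (Nat.le_of_ble_eq_true rfl)) ?_
  rintro σ₂ f₂ ⟨ha₂, hB₂⟩
  refine Runs.seq (Q := fun υ => υ.arr = σ.arr ∧ υ.reg rItem = (b + (m + 1) : ℕ))
    (runs_of_wp (by
      simp only [wp, Expr.eval, f₁.reg rM1 rfl, f₂.reg rM1 rfl, hm1, hB₂, Function.update_self]
      exact ⟨ha₂, by push_cast; rfl⟩) (Nat.le_of_ble_eq_true rfl)) ?_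
  rintro σ₃ f₃ ⟨ha₃, hI₃⟩
  refine Runs.seq (runs_itemTable (S := S) (D := D) (base := b + (m + 1)) (m := m) (M := M) (T := T)
    (u := 2 * w) (X := X) (((hI.of_frame f₁ rfl rfl).of_frame f₂ rfl rfl).of_frame f₃ rfl rfl)
    hn hMS (by rw [f₃.reg rM rfl, f₂.reg rM rfl, f₁.reg rM rfl, hm])
    (by rw [f₃.reg rMK rfl, f₂.reg rMK rfl, f₁.reg rMK rfl, hMK]) hI₃
    (by rw [f₃.reg rU rfl, f₂.reg rU rfl, hU₁]) (by omega) hS (by omega) (by linarith)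
    (by rwa [ha₃]) (by rwa [ha₃]) (by rwa [ha₃])) ?_
  intro σ₄ f₄ hitem
  have hIC := hitem.complete hm0 hT (by linarith) (by rwa [ha₃]) hM
  obtain ⟨X₄, d₄, p₄, fr₄, -, s₄, -⟩ := hitem
  rw [ha₃] at p₄
  have r₄ : σ₄.reg rM1 = (m + 1 : ℕ) := by
    rw [f₄.reg rM1 rfl, f₃.reg rM1 rfl, f₂.reg rM1 rfl, f₁.reg rM1 rfl, hm1]
  have rm₄ : σ₄.reg rM = m := by
    rw [f₄.reg rM rfl, f₃.reg rM rfl, f₂.reg rM rfl, f₁.reg rM rfl, hm]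
  have rB₄ : σ₄.reg rBase = b := by rw [f₄.reg rBase rfl, f₃.reg rBase rfl, hB₂]
  have rI₄ : σ₄.reg rItem = (b + (m + 1) : ℕ) := by rw [f₄.reg rItem rfl, hI₃]
  have rU₄ : σ₄.reg rU = 2 * w := by rw [f₄.reg rU rfl, f₃.reg rU rfl, f₂.reg rU rfl, hU₁]
  refine Runs.seq (Q := fun υ => υ.arr = σ₄.arr ∧ υ.reg rA1 = b ∧ υ.reg rA2 = b ∧
    υ.reg rDst = (b + (m + 1) + (m + 1) : ℕ))
    (runs_of_wp (by simp [wp, Expr.eval, rB₄, rI₄, r₄]) (Nat.le_of_ble_eq_true rfl)) ?_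
  rintro σ₅ f₅ ⟨ha₅, rA₅, rA2₅, rD₅⟩
  refine Runs.seq (runs_conv (S := S) (D := D) (c := 2) (u := w) (X := X₄)
    (by rw [f₅.reg rM rfl, rm₄]) (by rw [f₅.reg rM1 rfl, r₄]) rA₅ rA2₅ rD₅ (by omega) hS
    (by omega) (by omega) hu'.le (by rw [ha₅]; exact d₄.mono (by omega)) (by rwa [ha₅])
    (by rw [ha₅]; exact hXs.congr (by omega) p₄)
    (by rw [ha₅]; exact hXs.congr (by omega) p₄)) ?_
  rintro σ₆ f₆ ⟨X₆, d₆, p₆, fr₆, -, s₆, c₆⟩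
  rw [ha₅] at p₆ c₆
  have rD₆ : σ₆.reg rDst = (b + (m + 1) + (m + 1) : ℕ) := by rw [f₆.reg rDst rfl, rD₅]
  have rI₆ : σ₆.reg rItem = (b + (m + 1) : ℕ) := by
    rw [f₆.reg rItem rfl, f₅.reg rItem rfl, rI₄]
  have r₆ : σ₆.reg rM1 = (m + 1 : ℕ) := by rw [f₆.reg rM1 rfl, f₅.reg rM1 rfl, r₄]
  refine Runs.seq (Q := fun υ => υ.arr = σ₆.arr ∧ υ.reg rA1 = (b + (m + 1) + (m + 1) : ℕ) ∧
    υ.reg rA2 = (b + (m + 1) : ℕ) ∧ υ.reg rDst = (b + (m + 1) + (m + 1) + (m + 1) : ℕ))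
    (runs_of_wp (by simp [wp, Expr.eval, rD₆, rI₆, r₆]) (Nat.le_of_ble_eq_true rfl)) ?_
  rintro σ₇ f₇ ⟨ha₇, rA₇, rA2₇, rD₇⟩
  refine Runs.mono (runs_conv (S := S) (D := D) (c := 1) (u := 2 * w) (X := X₆)
    (by rw [f₇.reg rM rfl, f₆.reg rM rfl, f₅.reg rM rfl, rm₄]) (by rw [f₇.reg rM1 rfl, r₆])
    rA₇ rA2₇ rD₇ (by omega) hS
    (by omega) (by omega) (by linarith) (by rw [ha₇]; exact d₆.mono (by omega)) (by rwa [ha₇])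
    (by rw [ha₇]; exact_mod_cast s₆)
    (by rw [ha₇]; exact s₄.congr (by omega) p₆)) le_rfl ?_
  rintro σ₈ f₈ ⟨X₈, d₈, p₈, fr₈, -, s₈, c₈⟩
  rw [ha₇] at p₈ c₈
  refine ⟨by rw [f₈.reg rU rfl, f₇.reg rU rfl, f₆.reg rU rfl, f₅.reg rU rfl, rU₄],
    X₈, d₈.mono (by omega), fr₈, by simpa using s₈, ?_⟩
  have hF : ∀ i ≤ m, σ₄.arr aF (b + i) = σ.arr aF (b + i) := fun i hi => (p₄ _ (by omega)).1
  have hF' : ∀ i ≤ m, σ₆.arr aF (b + (m + 1) + i) = σ₄.arr aF (b + (m + 1) + i) := fun i hi =>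
    (p₆ _ (by omega)).1
  -- The intermediate table of sums is the `GD` of the error estimate.
  refine hXc.step I hu' hIC (GD := fun i => σ₆.arr aF (b + (m + 1) + (m + 1) + i)) ?_ ?_
  · intro a ha a' ha'
    have := c₆ a ha a' ha' (Or.inl (by omega))
    rwa [hF a ha, hF a' ha'] at this
  · intro a ha a' ha'
    have := c₈ a ha a' ha' (Or.inl (by omega))
    rwa [hF' a' ha'] at this

/-- Compute all tables. -/
def levels : Prog 37 9 :=
  forLoop rL rK level

theorem runs_levels {I : UKP} {S D m M K : ℕ} {T u : ℝ} {σ : State 37 9}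
    (hI : Holds I σ) (hn : I.n ≤ S) (hMS : M ≤ S) (hm0 : 0 < m) (hT : 0 < T) (hu : 0 < u)
    (hm : σ.reg rM = m) (hm1 : σ.reg rM1 = (m + 1 : ℕ)) (hMK : σ.reg rMK = M)
    (hK : σ.reg rK = K) (hU : σ.reg rU = u)
    (hD : (3 * K + 1) * (m + 1) ≤ D) (hS : D ≤ S)
    (hRb : Buckets I T m I.n (σ.arr aB)) (hM : ∀ j, T < I.profit j → bucket m T (I.profit j) < M)
    (h : LevelInv I D m T u 0 (σ.arr aF) (σ.arr aL) (σ.arr aR) (σ.arr aJ)) :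
    Runs S levels σ (K * ((200 * ((m + 1) * (m + 1)) + 100 * M + 200) + 7) + 5) fun τ =>
      τ.reg rU = 2 ^ K * u ∧
      LevelInv I D m T u K (τ.arr aF) (τ.arr aL) (τ.arr aR) (τ.arr aJ) := by
  refine runs_forLoop (fun k τ => τ.reg rU = 2 ^ k * u ∧
    LevelInv I D m T u k (τ.arr aF) (τ.arr aL) (τ.arr aR) (τ.arr aJ)) hK (by decide) rfl rfl
    ⟨by simpa using hU, h⟩ ?_
  rintro k hk τ hτ hfr ⟨hUk, hinv⟩
  refine Runs.mono (runs_level (hI.of_frame hfr rfl rfl) hn hMS hm0 hT hu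
    (by rw [hfr.reg rM rfl, hm]) (by rw [hfr.reg rM1 rfl, hm1]) (by rw [hfr.reg rMK rfl, hMK])
    hτ hUk (le_trans (Nat.mul_le_mul_right _ (by omega)) hD) hS
    (by rwa [hfr.arr aB rfl]) hM hinv) le_rfl ?_
  rintro υ - ⟨h1, h2⟩
  exact ⟨by simpa using h1, h2⟩

/-! ### Parameters, greedy bound, sorting of the items, initial table. -/

/-- The accuracy that the program works with. -/
noncomputable def accuracy (ε : ℝ) : ℝ := if ε < 1 / 2 then ε else 1 / 2

/-- The number of levels of tables. -/
noncomputable def numLevels (ε : ℝ) : ℕ := ⌊Real.logb 2 (1 / accuracy ε)⌋₊ + 3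

/-- The largest index in a table. -/
noncomputable def tableSize (ε : ℝ) : ℕ := 12 * numLevels ε * (⌊1 / accuracy ε⌋₊ + 1)

/-- The number of cells of all tables. -/
noncomputable def numCells (ε : ℝ) : ℕ := (3 * numLevels ε + 1) * (tableSize ε + 1)

theorem accuracy_pos {ε : ℝ} (hε : 0 < ε) : 0 < accuracy ε := by
  unfold accuracy
  split_ifs <;> linarith

theorem accuracy_le_half (ε : ℝ) : accuracy ε ≤ 1 / 2 := by
  unfold accuracy
  split_ifs <;> linarith

theorem accuracy_le (ε : ℝ) : accuracy ε ≤ ε := by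
  unfold accuracy
  split_ifs <;> linarith

theorem two_le_inv_accuracy {ε : ℝ} (hε : 0 < ε) : 2 ≤ 1 / accuracy ε := by
  rw [le_div_iff₀ (accuracy_pos hε)]
  linarith [accuracy_le_half ε]

theorem logb_accuracy_nonneg {ε : ℝ} (hε : 0 < ε) : 0 ≤ Real.logb 2 (1 / accuracy ε) :=
  Real.logb_nonneg (by norm_num) (by linarith [two_le_inv_accuracy hε])

/-- Compute the parameters. -/
def params : Prog 37 9 :=
  .seq (.branch (.lt (.reg rEps) (.div (.lit 1) (.lit 2))) (.assign rE (.reg rEps))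
    (.assign rE (.div (.lit 1) (.lit 2)))) <|
  .seq (.assign rK (.add (.floor (.log (.div (.lit 1) (.reg rE)))) (.lit 3))) <|
  .seq (.assign rM (.mul (.mul (.lit 12) (.reg rK))
    (.add (.floor (.div (.lit 1) (.reg rE))) (.lit 1)))) <|
  .seq (.assign rM1 (.add (.reg rM) (.lit 1))) <|
  .seq (.assign rMK (.mul (.reg rM) (.reg rK))) <|
  .seq (.assign rD (.mul (.add (.mul (.lit 3) (.reg rK)) (.lit 1)) (.reg rM1))) <|
  .seq (.assign rD1 (.sub (.reg rD) (.lit 1))) (.assign rH (.lit 1))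

theorem runs_params {S : ℕ} {ε : ℝ} (hε : 0 < ε) {σ : State 37 9} (h : σ.reg rEps = ε) :
    Runs S params σ 100 fun τ => τ.reg rK = numLevels ε ∧ τ.reg rM = tableSize ε ∧
      τ.reg rM1 = (tableSize ε + 1 : ℕ) ∧ τ.reg rMK = (tableSize ε * numLevels ε : ℕ) ∧
      τ.reg rD = numCells ε ∧ τ.reg rD1 = (numCells ε - 1 : ℕ) ∧ τ.reg rH = 1 := by
  refine Runs.mono (t := 12 + 88) (Runs.seq (Q := fun τ => τ.reg rE = accuracy ε) (runs_of_wp ?_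
    (Nat.le_of_ble_eq_true rfl)) ?_) le_rfl (fun _ _ h => h)
  · simp only [wp, Expr.eval, Test.Holds, h, Function.update_self, accuracy, Nat.cast_one,
      Nat.cast_ofNat]
    exact ⟨fun h => (if_pos h).symm, fun h => (if_neg h).symm⟩
  intro τ _ hτ
  have hK : ((⌊Real.logb 2 (1 / accuracy ε)⌋ : ℤ) : ℝ) + 3 = numLevels ε := by
    rw [numLevels, ← natCast_floor_eq_intCast_floor (logb_accuracy_nonneg hε)]
    push_cast
    rfl
  have hm : 12 * (numLevels ε : ℝ) * (((⌊1 / accuracy ε⌋ : ℤ) : ℝ) + 1) = tableSize ε := by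
    rw [tableSize, ← natCast_floor_eq_intCast_floor (by linarith [two_le_inv_accuracy hε])]
    push_cast
    rfl
  have hD : 1 ≤ numCells ε := Nat.mul_pos (by omega) (by omega)
  refine runs_of_wp ?_ (Nat.le_of_ble_eq_true rfl)
  simp [wp, Expr.eval, hτ, -one_div, hK, hm]
  rw [Nat.cast_sub hD, numCells]
  push_cast
  exact ⟨rfl, rfl⟩

/-- Compute the power of two in `rH`. -/
def power : Prog 37 9 := forLoop rJ rK <| .assign rH (.mul (.lit 2) (.reg rH))

theorem runs_power {S K : ℕ} {σ : State 37 9} (hK : σ.reg rK = K) (h : σ.reg rH = 1) :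
    Runs S power σ (K * (4 + 7) + 5) fun τ => τ.reg rH = 2 ^ K := by
  refine runs_forLoop (fun k τ => τ.reg rH = 2 ^ k) hK (by decide) rfl rfl (by simpa using h) ?_
  intro k _ τ _ _ hinv
  refine runs_of_wp ?_ (Nat.le_of_ble_eq_true rfl)
  simp [wp, Expr.eval, hinv, pow_succ, mul_comm]

/-- Find the best packing with copies of one item only. -/
def greedy : Prog 37 9 :=
  forLoop rJ rN <|
  .seq (.load rp aP (.reg rJ)) <|
  .seq (.load rs aS (.reg rJ)) <|
  .seq (.assign rv (.mul (.reg rp) (.floor (.div (.lit 1) (.reg rs))))) <|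
  .branch (.lt (.reg rP) (.reg rv)) (.assign rP (.reg rv)) .skip

theorem runs_greedy {I : UKP} (hn : 0 < I.n) {S : ℕ} {σ : State 37 9} (hI : Holds I σ)
    (hS : I.n ≤ S) (hN : σ.reg rN = I.n) (h : σ.reg rP = 0) :
    Runs S greedy σ (I.n * (40 + 7) + 5) fun τ =>
      (∀ j, I.profit j * ((⌊1 / I.size j⌋ : ℤ) : ℝ) ≤ τ.reg rP) ∧
      ∃ j, τ.reg rP = I.profit j * ((⌊1 / I.size j⌋ : ℤ) : ℝ) := by
  refine Runs.mono (runs_forLoop (fun t τ =>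
    (∀ j : Fin I.n, j < t → I.profit j * ((⌊1 / I.size j⌋ : ℤ) : ℝ) ≤ τ.reg rP) ∧
      (τ.reg rP = 0 ∨ ∃ j, τ.reg rP = I.profit j * ((⌊1 / I.size j⌋ : ℤ) : ℝ))) (t := 40)
      hN (by decide) rfl rfl ⟨fun j hj => absurd hj (Nat.not_lt_zero _), Or.inl h⟩ ?_) le_rfl ?_
  · rintro t ht τ hτ hf ⟨h1, h2⟩
    obtain ⟨hp, hs⟩ := (hI.of_frame hf rfl rfl) ⟨t, ht⟩
    simp only at hp hs
    refine runs_of_wp ?_ (Nat.le_of_ble_eq_true rfl)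
    simp only [wp, Expr.eval, Test.Holds]
    refine ⟨t, hτ, by omega, t, by simp [hτ], by omega, ?_⟩
    simp [-one_div, hp, hs]
    refine ⟨fun hlt => ⟨fun j hj => ?_, Or.inr ⟨⟨t, ht⟩, rfl⟩⟩, fun hle => ⟨fun j hj => ?_, h2⟩⟩ <;>
      rcases Nat.lt_or_eq_of_le hj with hjt | rfl
    · exact (h1 j hjt).trans hlt.le
    · exact le_rfl
    · exact h1 j hjt
    · exact hle
  · rintro τ - ⟨h1, h2⟩
    -- The initial value 0 cannot survive, because there is an item and its profit is positive.
    refine ⟨fun j => h1 j j.2, h2.resolve_left fun h0 => ?_⟩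
    have h3 := h1 ⟨0, hn⟩ hn
    have h4 := I.profit_le_mul_floor ⟨0, hn⟩
    have h5 := (I.profit_mem ⟨0, hn⟩).1
    linarith

/-- Compute the threshold for small items and the unit of the first table. -/
def threshold : Prog 37 9 :=
  .seq (.assign rT (.div (.mul (.lit 2) (.reg rP)) (.reg rH))) <|
  .seq (.assign rU (.div (.reg rT) (.reg rM))) (.assign rSb (.lit 2))

/-- Sort item `rJ` into the buckets or compare it with the best small item. -/
def scanStep : Prog 37 9 :=
  .seq (.load rp aP (.reg rJ)) <|
  .seq (.load rs aS (.reg rJ)) <|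
  .branch (.le (.reg rp) (.reg rT))
    (.branch (.lt (.mul (.reg rPb) (.reg rs)) (.mul (.reg rp) (.reg rSb)))
      (.seq (.assign rPb (.reg rp)) <| .seq (.assign rSb (.reg rs)) (.assign rB (.reg rJ)))
      .skip)
    (.seq (.assign rIdx (.floor (.mul (.reg rM) (.log (.div (.reg rp) (.reg rT)))))) <|
      .seq (.load rr aB (.reg rIdx)) <|
      .branch (.lt (.lit 0) (.reg rr))
        (.seq (.load rf aS (.sub (.reg rr) (.lit 1))) <|
          .branch (.lt (.reg rs) (.reg rf))
            (.store aB (.reg rIdx) (.add (.reg rJ) (.lit 1)))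
            .skip)
        (.store aB (.reg rIdx) (.add (.reg rJ) (.lit 1))))

/-- Sort all items. -/
def scan : Prog 37 9 := forLoop rJ rN scanStep

theorem runs_scan {I : UKP} {S m M : ℕ} {T : ℝ} {σ : State 37 9} (hI : Holds I σ)
    (hS : I.n ≤ S) (hMS : M ≤ S) (hT : 0 < T) (hN : σ.reg rN = I.n) (hm : σ.reg rM = m)
    (hTr : σ.reg rT = T) (hM : ∀ j, T < I.profit j → bucket m T (I.profit j) < M)
    (hB : BestSmall I T 0 (σ.reg rPb) (σ.reg rSb) (σ.reg rB)) (h0 : ∀ q, σ.arr aB q = 0) :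
    Runs S scan σ (I.n * (100 + 7) + 5) fun τ =>
      Buckets I T m I.n (τ.arr aB) ∧
      BestSmall I T I.n (τ.reg rPb) (τ.reg rSb) (τ.reg rB) := by
  refine runs_forLoop (fun t τ => Buckets I T m t (τ.arr aB) ∧
      BestSmall I T t (τ.reg rPb) (τ.reg rSb) (τ.reg rB)) hN (by decide) rfl rfl
      ⟨⟨fun q => Or.inl (h0 q), fun j hj => absurd hj (Nat.not_lt_zero _)⟩, hB⟩ ?_
  rintro t ht τ hτ hf ⟨h1, h2⟩
  have hI' := hI.of_frame hf rfl rfl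
  obtain ⟨hp, hs⟩ := hI' ⟨t, ht⟩
  have e1 : τ.reg rM = m := by rw [hf.reg rM rfl, hm]
  have e2 : τ.reg rT = T := by rw [hf.reg rT rfl, hTr]
  simp only at hp hs
  refine runs_of_wp ?_ (Nat.le_of_ble_eq_true rfl)
  simp only [scanStep, wp, Expr.eval, Test.Holds]
  refine ⟨t, hτ, by omega, t, by simp [hτ], by omega, fun hle => ?_, fun hlt => ?_⟩
  · simp [e2, hp, hs, hτ] at hle ⊢
    exact ⟨fun h => ⟨h1.keep_small ht hle, h2.set ht hle h⟩,
      fun h => ⟨h1.keep_small ht hle, h2.keep_small ht h⟩⟩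
  · simp [e2, hp] at hlt
    have hidx := floor_eq_bucket m hT hlt
    have hb := hM _ hlt
    simp [e1, e2, hp, hs, hτ]
    rcases h1.mem (bucket m T (I.profit ⟨t, ht⟩)) with h3 | ⟨j, hj, -, -⟩
    · refine ⟨_, hidx, by omega, fun h => absurd h (by simp [h3]), fun _ => ?_⟩
      refine ⟨_, hidx, by omega, h1.set ht hlt fun j' hj' => ?_, h2.keep_large ht hlt⟩
      rw [h3] at hj'
      have : (0 : ℝ) ≤ (j' : ℕ) := Nat.cast_nonneg _
      linarith
    · have hpos : (0 : ℝ) < ((j : ℕ) : ℝ) + 1 := by positivity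
      refine ⟨_, hidx, by omega, fun _ => ?_, fun h => absurd h (by rw [hj]; exact not_le.mpr hpos)⟩
      refine ⟨j, by simp [hj], by omega, ?_⟩
      simp only [(hI' j).2]
      refine ⟨fun h => ⟨_, hidx, by omega, h1.set ht hlt fun j' hj' => ?_,
        h2.keep_large ht hlt⟩, fun h => ⟨h1.keep_large ht j hj h, h2.keep_large ht hlt⟩⟩
      rw [hj] at hj'
      have : (j : ℕ) = j' := by exact_mod_cast add_right_cancel hj'
      obtain rfl : j = j' := Fin.ext this
      exact h.le

/-- Initialize the tables. -/
def clear : Prog 37 9 :=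
  .seq (forLoop rJ rD (.store aF (.reg rJ) (.lit 2))) (.store aF (.lit 0) (.lit 0))

theorem runs_clear {I : UKP} {S m D : ℕ} {T u : ℝ} {σ : State 37 9} (hD : σ.reg rD = D)
    (hS : D ≤ S) (hm : m + 1 ≤ D) (hu : m * u ≤ T) (hL : σ.arr aL = fun _ => 0)
    (hR : σ.arr aR = fun _ => 0) (hJ : σ.arr aJ = fun _ => 0) :
    Runs S clear σ (D * (3 + 7) + 5 + 3) fun τ =>
      LevelInv I D m T u 0 (τ.arr aF) (τ.arr aL) (τ.arr aR) (τ.arr aJ) := by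
  refine Runs.seq (runs_forLoop (fun k τ => ∀ d < k, τ.arr aF d = 2) hD (by decide) rfl rfl
    (by simp) ?_) ?_
  · intro k hk τ hτ _ hinv
    refine runs_of_wp ?_ (Nat.le_of_ble_eq_true rfl)
    refine ⟨k, hτ, by omega, fun d hd => ?_⟩
    by_cases hdk : d = k
    · subst hdk
      simp [Expr.eval]
    · simpa [hdk] using hinv d (by omega)
  · intro τ hf hinv
    refine runs_of_wp ?_ (Nat.le_of_ble_eq_true rfl)
    refine ⟨0, by simp [Expr.eval], by omega, ?_⟩
    have := LevelInv.zero (I := I) hinv hm hu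
    simpa [hf.arr aL rfl, hf.arr aR rfl, hf.arr aJ rfl, hL, hR, hJ, Expr.eval] using this

/-! ### Choosing the best entry and writing the output. -/

/-- Consider the entry `rJ` of the last table, completed by small items. -/
def pickStep : Prog 37 9 :=
  .seq (.load rf aF (.add (.reg rBase) (.reg rJ))) <|
  .branch (.le (.reg rf) (.lit 1))
    (.seq (.assign rC (.floor (.div (.sub (.lit 1) (.reg rf)) (.reg rSb)))) <|
      .seq (.assign rv (.add (.mul (.reg rJ) (.reg rU)) (.mul (.reg rPb) (.reg rC)))) <|
      .branch (.lt (.reg rBest) (.reg rv))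
        (.seq (.assign rBest (.reg rv)) <|
          .seq (.assign rArg (.add (.reg rBase) (.reg rJ))) (.assign rFill (.reg rC)))
        .skip)
    .skip

/-- Find the best entry of the last table. -/
def pick : Prog 37 9 :=
  .seq (.seq (.assign rBest (.sub (.lit 0) (.lit 1)))
    (.assign rBase (.mul (.mul (.lit 3) (.reg rK)) (.reg rM1)))) <|
  forLoop rJ rM1 pickStep

theorem runs_pick {S m K base : ℕ} {U pb sb : ℝ} {σ : State 37 9} (hK : σ.reg rK = K)
    (hm1 : σ.reg rM1 = (m + 1 : ℕ)) (hbase : base = 3 * K * (m + 1)) (hS : base + m < S)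
    (hU : σ.reg rU = U) (hpb : σ.reg rPb = pb) (hsb : σ.reg rSb = sb) (hU0 : 0 ≤ U)
    (hpb0 : 0 ≤ pb) (hsb0 : 0 < sb) (hex : ∃ i ≤ m, σ.arr aF (base + i) ≤ 1) :
    Runs S pick σ (20 + ((m + 1) * (60 + 7) + 5)) fun τ =>
      ∃ i ≤ m, τ.reg rArg = (base + i : ℕ) ∧ σ.arr aF (base + i) ≤ 1 ∧
        τ.reg rFill = ((⌊(1 - σ.arr aF (base + i)) / sb⌋ : ℤ) : ℝ) ∧
        ∀ i' ≤ m, σ.arr aF (base + i') ≤ 1 →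
          i' * U + pb * ((⌊(1 - σ.arr aF (base + i')) / sb⌋ : ℤ) : ℝ) ≤
          i * U + pb * ((⌊(1 - σ.arr aF (base + i)) / sb⌋ : ℤ) : ℝ) := by
  refine Runs.seq (Q := fun τ => τ.arr = σ.arr ∧ τ.reg rBest = -1 ∧ τ.reg rBase = base)
    (runs_of_wp (by simp [wp, Expr.eval, hK, hm1, hbase]) (Nat.le_of_ble_eq_true rfl)) ?_
  rintro τ hf ⟨harr, hbest, hb⟩
  refine Runs.mono (runs_forLoop (fun t υ =>
    (υ.reg rBest = -1 ∨ ∃ i ≤ m, υ.reg rArg = (base + i : ℕ) ∧ σ.arr aF (base + i) ≤ 1 ∧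
        υ.reg rFill = ((⌊(1 - σ.arr aF (base + i)) / sb⌋ : ℤ) : ℝ) ∧
        υ.reg rBest = i * U + pb * ((⌊(1 - σ.arr aF (base + i)) / sb⌋ : ℤ) : ℝ)) ∧
    ∀ i' < t, σ.arr aF (base + i') ≤ 1 →
      i' * U + pb * ((⌊(1 - σ.arr aF (base + i')) / sb⌋ : ℤ) : ℝ) ≤ υ.reg rBest) (t := 60)
    (by rw [hf.reg rM1 rfl, hm1]) (by decide) rfl rfl ⟨Or.inl hbest, by simp⟩ ?_) le_rfl ?_
  · rintro t ht υ hυ hf' ⟨h1, h2⟩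
    have e1 : υ.reg rBase = base := by rw [hf'.reg rBase rfl, hb]
    have e2 : υ.reg rU = U := by rw [hf'.reg rU rfl, hf.reg rU rfl, hU]
    have e3 : υ.reg rPb = pb := by rw [hf'.reg rPb rfl, hf.reg rPb rfl, hpb]
    have e4 : υ.reg rSb = sb := by rw [hf'.reg rSb rfl, hf.reg rSb rfl, hsb]
    have e5 : υ.arr aF = σ.arr aF := by rw [hf'.arr aF rfl, harr]
    refine runs_of_wp ?_ (Nat.le_of_ble_eq_true rfl)
    simp only [pickStep, wp, Expr.eval, Test.Holds]
    refine ⟨base + t, by rw [e1, hυ]; push_cast; rfl, by omega, fun hle => ?_, fun hgt => ?_⟩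
    · simp [e5] at hle
      simp [e1, e2, e3, e4, e5, hυ]
      refine ⟨fun hlt => ⟨Or.inr ⟨by omega, hle⟩, fun i' hi' hF => ?_⟩,
        fun hge => ⟨by simpa using h1, fun i' hi' hF => ?_⟩⟩ <;>
        rcases Nat.lt_or_eq_of_le hi' with hlt' | rfl
      · exact (h2 i' hlt' hF).trans hlt.le
      · exact le_rfl
      · exact h2 i' hlt' hF
      · exact hge
    · simp [e5] at hgt
      refine ⟨by simpa using h1, fun i' hi' hF => ?_⟩
      rcases Nat.lt_succ_iff_lt_or_eq.mp hi' with hlt' | rfl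
      · simpa using h2 i' hlt' hF
      · exact absurd hF (not_le.mpr hgt)
  · rintro υ - ⟨h1, h2⟩
    rcases h1 with h1 | ⟨i, hi, h3, h4, h5, h6⟩
    -- The initial value -1 is below every candidate, so it is replaced as soon as a feasible entry
    -- occurs.
    · obtain ⟨i, hi, hF⟩ := hex
      have h3 := h2 i (by omega) hF
      have h4 : (0 : ℝ) ≤ ((⌊(1 - σ.arr aF (base + i)) / sb⌋ : ℤ) : ℝ) := by
        exact_mod_cast Int.floor_nonneg.mpr (div_nonneg (by linarith) hsb0.le)
      have h5 : 0 ≤ (i : ℝ) * U := by positivity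
      have h6 := mul_nonneg hpb0 h4
      linarith
    · exact ⟨i, hi, h3, h4, h5, fun i' hi' hF => h6 ▸ h2 i' (by omega) hF⟩

/-- Unfold the packing of the cell `rD1 - rJ` once. -/
def unfoldStep : Prog 37 9 :=
  .seq (.assign rd (.sub (.reg rD1) (.reg rJ))) <|
  .seq (.load rC aC (.reg rd)) <|
  .seq (.load rr aJ (.reg rd)) <|
  .branch (.lt (.lit 0) (.reg rr))
    (.seq (.load rv aX (.sub (.reg rr) (.lit 1)))
      (.store aX (.sub (.reg rr) (.lit 1)) (.add (.reg rv) (.reg rC))))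
    (.seq (.load rA1 aL (.reg rd)) <|
      .seq (.load rv aC (.reg rA1)) <|
      .seq (.store aC (.reg rA1) (.add (.reg rv) (.reg rC))) <|
      .seq (.load rA1 aR (.reg rd)) <|
      .seq (.load rv aC (.reg rA1)) <|
      .store aC (.reg rA1) (.add (.reg rv) (.reg rC)))

/-- Write the packing of the cell `rArg` to the output. -/
def unfoldAll : Prog 37 9 :=
  .seq (.store aC (.reg rArg) (.lit 1)) (forLoop rJ rD1 unfoldStep)

theorem runs_unfoldAll {I : UKP} {S D cur d : ℕ} {X : ℕ → Fin I.n → ℕ} {σ : State 37 9}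
    (hn : I.n ≤ S) (hS : D ≤ S) (hD1 : σ.reg rD1 = (D - 1 : ℕ)) (harg : σ.reg rArg = d)
    (hd : d < D) (hX : Dag I D cur (σ.arr aF) (σ.arr aL) (σ.arr aR) (σ.arr aJ) X)
    (hx : ∀ j, σ.arr aX j = 0) (hc : ∀ e, σ.arr aC e = 0) :
    Runs S unfoldAll σ (3 + ((D - 1) * (60 + 7) + 5)) fun τ =>
      ∀ j : Fin I.n, τ.arr aX j = X d j := by
  refine Runs.seq (Q := fun τ => BackInv I X (X d) (D - 0) (τ.arr aC) (τ.arr aX))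
    (runs_of_wp ?_ (Nat.le_of_ble_eq_true rfl)) ?_
  · refine ⟨d, by simp [Expr.eval, harg], by omega, ?_⟩
    simpa [Expr.eval] using BackInv.init hd hc hx
  intro τ hf hτ
  refine Runs.mono (runs_forLoop (fun k υ => BackInv I X (X d) (D - k) (υ.arr aC) (υ.arr aX))
    (t := 60) (by rw [hf.reg rD1 rfl, hD1]) (by decide) rfl rfl hτ ?_) le_rfl ?_
  · intro k hk υ hυ hf' hinv
    have e1 : υ.reg rD1 = (D - 1 : ℕ) := by rw [hf'.reg rD1 rfl, hf.reg rD1 rfl, hD1]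
    have e2 : υ.arr aJ = σ.arr aJ := by rw [hf'.arr aJ rfl, hf.arr aJ rfl]
    have e3 : υ.arr aL = σ.arr aL := by rw [hf'.arr aL rfl, hf.arr aL rfl]
    have e4 : υ.arr aR = σ.arr aR := by rw [hf'.arr aR rfl, hf.arr aR rfl]
    obtain ⟨e, he⟩ : ∃ e, D - k = e + 1 := ⟨D - k - 1, by omega⟩
    have he' : D - (k + 1) = e := by omega
    have he1 : ((D - 1 : ℕ) : ℝ) - k = e := by
      rw [← Nat.cast_sub (by omega)]
      congr 1
      omega
    rw [he] at hinv
    rw [he']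
    refine runs_of_wp ?_ (Nat.le_of_ble_eq_true rfl)
    simp only [unfoldStep, wp, Expr.eval, Test.Holds]
    refine ⟨e, by simp [e1, hυ, he1], by omega, e, by simp [e1, hυ, he1], by omega, ?_⟩
    rcases hX.node e (by omega) with ⟨j, hj, hXe⟩ | ⟨hJ, a, b, hL, hR, ha, hb, -, -, hXe⟩
    · have hpos : (0 : ℝ) < ((j : ℕ) : ℝ) + 1 := by positivity
      refine ⟨fun _ => ?_, fun h => absurd (by simpa [e2, hj] using hpos) h⟩
      refine ⟨j, by simp [e2, hj], by omega, j, by simp [e2, hj], by omega, ?_⟩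
      simpa [e2, hj] using hinv.item j hXe
    · refine ⟨fun h => absurd h (by simp [e2, hJ]), fun _ => ?_⟩
      refine ⟨e, by simp [e1, hυ, he1], by omega, a, by simp [e3, hL], by omega,
        a, by simp [e3, hL], by omega, e, by simp [e1, hυ, he1], by omega,
        b, by simp [e4, hR], by omega, b, by simp [e4, hR], by omega, ?_⟩
      simpa using hinv.node hXe (by omega) (by omega)
  · intro υ _ hinv j
    -- The sweep stops before cell 0, whose packing is empty.
    rw [show D - (D - 1) = 1 by omega] at hinv
    exact hinv.done hX.zero j

/-- Add the copies of the small item to the output. -/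
def fillUp : Prog 37 9 :=
  .seq (.load rv aX (.reg rB)) (.store aX (.reg rB) (.add (.reg rv) (.reg rFill)))

theorem runs_fillUp {I : UKP} {S k : ℕ} {x : Fin I.n → ℕ} {j : Fin I.n} {σ : State 37 9}
    (hn : I.n ≤ S) (hB : σ.reg rB = (j : ℕ)) (hk : σ.reg rFill = k)
    (hx : ∀ i : Fin I.n, σ.arr aX i = x i) :
    Runs S fillUp σ 20 fun τ =>
      ∀ i : Fin I.n, τ.arr aX i = ((x + Pi.single j k : Fin I.n → ℕ) i : ℝ) := by
  refine runs_of_wp ?_ (Nat.le_of_ble_eq_true rfl)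
  simp only [fillUp, wp, Expr.eval]
  refine ⟨j, hB, by omega, j, by simp [hB], by omega, fun i => ?_⟩
  by_cases hij : i = j
  · subst hij
    simp [hx, hk]
  · have : (i : ℕ) ≠ j := fun h => hij (Fin.ext h)
    simp [this, hij, hx]

/-! ### The complete scheme and its error. -/

/-- The approximation scheme. -/
def fptas : Prog 37 9 :=
  .seq params <| .seq power <| .seq greedy <| .seq threshold <| .seq scan <| .seq clear <|
    .seq levels <| .seq pick <| .seq unfoldAll fillUp

theorem numLevels_pos (ε : ℝ) : 0 < numLevels ε := by unfold numLevels; omega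

theorem numLevels_le_tableSize (ε : ℝ) : numLevels ε ≤ tableSize ε := by
  unfold tableSize
  nlinarith [numLevels_pos ε, Nat.zero_le ⌊1 / accuracy ε⌋₊]

theorem tableSize_pos (ε : ℝ) : 0 < tableSize ε :=
  (numLevels_pos ε).trans_le (numLevels_le_tableSize ε)

/-- Of the three extra levels one makes up for rounding the logarithm and two give the factor 4,
which yields T = 2P/2^K ≤ eP/2. -/
theorem four_le_mul_two_pow {ε : ℝ} (hε : 0 < ε) : 4 ≤ accuracy ε * 2 ^ numLevels ε := by
  have hpos := accuracy_pos hε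
  have h1 := (Nat.lt_floor_add_one (Real.logb 2 (1 / accuracy ε))).le
  rw [Real.logb_le_iff_le_rpow (by norm_num) (by positivity), div_le_iff₀ hpos] at h1
  have h2 : (2 : ℝ) ^ ((⌊Real.logb 2 (1 / accuracy ε)⌋₊ : ℝ) + 1) =
      2 ^ (⌊Real.logb 2 (1 / accuracy ε)⌋₊ + 1) := by exact_mod_cast Real.rpow_natCast 2 _
  rw [h2] at h1
  have h3 : (2 : ℝ) ^ numLevels ε = 2 ^ (⌊Real.logb 2 (1 / accuracy ε)⌋₊ + 1) * 4 := by
    rw [numLevels]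
    ring
  rw [h3]
  linarith

/-- With the last unit U = 2P/m, this is exactly what makes the accumulated error 3K·U at most eP/2.
-/
theorem mul_numLevels_le {ε : ℝ} (hε : 0 < ε) :
    12 * (numLevels ε : ℝ) ≤ accuracy ε * tableSize ε := by
  have hpos := accuracy_pos hε
  have h1 := (Nat.lt_floor_add_one (1 / accuracy ε)).le
  rw [div_le_iff₀ hpos] at h1
  have hK : (0 : ℝ) ≤ 12 * numLevels ε := by positivity
  have := mul_le_mul_of_nonneg_left h1 hK
  rw [tableSize]
  push_cast
  linarith

/-- An upper bound for the running time, with `K` levels of tables of size `m`. -/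
def time (n K m : ℕ) : ℕ :=
  100 + ((K * (4 + 7) + 5) + ((n * (40 + 7) + 5) + (20 + ((n * (100 + 7) + 5) +
    (((3 * K + 1) * (m + 1) * (3 + 7) + 5 + 3) +
    ((K * ((200 * ((m + 1) * (m + 1)) + 100 * (m * K) + 200) + 7) + 5) +
    ((20 + ((m + 1) * (60 + 7) + 5)) +
    ((3 + (((3 * K + 1) * (m + 1) - 1) * (60 + 7) + 5)) + 20))))))))

theorem holds_initState (I : UKP) (ε : ℝ) : Holds I (initState 35 6 I ε) := by
  intro j
  constructor
  · change (if h : (j : ℕ) < I.n then I.profit ⟨j, h⟩ else 0) = _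
    rw [dif_pos j.2]
  · change (if h : (j : ℕ) < I.n then I.size ⟨j, h⟩ else 0) = _
    rw [dif_pos j.2]

theorem runs_fptas (I : UKP) {ε : ℝ} (hn : 0 < I.n) (hε : 0 < ε) {S : ℕ} (hnS : I.n ≤ S)
    (hDS : numCells ε ≤ S) (hMS : tableSize ε * numLevels ε ≤ S) :
    Runs S fptas (initState 35 6 I ε) (time I.n (numLevels ε) (tableSize ε)) fun τ =>
      ∃ x : Fin I.n → ℕ, (∀ j : Fin I.n, τ.arr aX (j : ℕ) = (x j : ℝ)) ∧ I.Feasible x ∧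
        (1 - ε) * I.OPT ≤ I.value x := by
  have hK0 := numLevels_pos ε
  have hm0 := tableSize_pos ε
  have h4 := four_le_mul_two_pow hε
  have h12 := mul_numLevels_le hε
  have hacc := accuracy_le ε
  have hI := holds_initState I ε
  have hDdef : numCells ε = (3 * numLevels ε + 1) * (tableSize ε + 1) := rfl
  rw [time, ← hDdef]
  refine Runs.seq (runs_params hε rfl) ?_
  rintro σ₁ f₁ ⟨rK₁, rM₁, rM1₁, rMK₁, rD₁, rD1₁, rH₁⟩
  generalize numLevels ε = K at *
  generalize tableSize ε = m at *
  generalize accuracy ε = e at *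
  generalize numCells ε = D at *
  have hm0' : (0 : ℝ) < m := by exact_mod_cast hm0
  have hmD : m + 1 ≤ D := by rw [hDdef]; nlinarith
  refine Runs.seq (runs_power rK₁ rH₁) ?_
  intro σ₂ f₂ rH₂
  have hI₂ := (hI.of_frame f₁ rfl rfl).of_frame f₂ rfl rfl
  refine Runs.seq (runs_greedy hn hI₂ hnS (by rw [f₂.reg rN rfl, f₁.reg rN rfl]; rfl)
    (by rw [f₂.reg rP rfl, f₁.reg rP rfl]; rfl)) ?_
  rintro σ₃ f₃ ⟨hP, jP, hjP⟩
  have hI₃ := hI₂.of_frame f₃ rfl rfl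
  generalize hPr : σ₃.reg rP = P at *
  have hpP : ∀ j, I.profit j ≤ P := fun j => (I.profit_le_mul_floor j).trans (hP j)
  have hP0 : 0 < P := (I.profit_mem jP).1.trans_le (hpP jP)
  have hPO : P ≤ I.OPT := hjP ▸ I.profit_mul_floor_le_OPT jP
  have h2K : (0 : ℝ) < 2 ^ K := by positivity
  refine Runs.seq (Q := fun τ => τ.arr = σ₃.arr ∧ τ.reg rT = 2 * P / 2 ^ K ∧
    τ.reg rU = 2 * P / 2 ^ K / m ∧ τ.reg rSb = 2)
    (runs_of_wp (by
      simp [threshold, wp, Expr.eval, hPr, f₃.reg rH rfl, rH₂, f₃.reg rM rfl, f₂.reg rM rfl, rM₁])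
      (Nat.le_of_ble_eq_true rfl)) ?_
  rintro σ₄ f₄ ⟨-, rT₄, rU₄, rSb₄⟩
  have hT0 : 0 < 2 * P / 2 ^ K := by positivity
  have hKT : 2 ^ K * (2 * P / 2 ^ K) = 2 * P := by field_simp
  have hTe : 2 * P / 2 ^ K ≤ e * P / 2 := by
    rw [div_le_iff₀ h2K]
    nlinarith
  generalize 2 * P / 2 ^ K = T at *
  -- No profit exceeds P, and P < 2P = 2^K·T, so mK classes suffice.
  have hM : ∀ j, T < I.profit j → bucket m T (I.profit j) < m * K := fun j hj =>
    bucket_lt hm0 hT0 hj (by rw [hKT]; linarith [hpP j])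
  have hI₄ := hI₃.of_frame f₄ rfl rfl
  have rM₄ : σ₄.reg rM = m := by rw [f₄.reg rM rfl, f₃.reg rM rfl, f₂.reg rM rfl, rM₁]
  have hz : ∀ A, params.keepsArr A = true → power.keepsArr A = true →
      greedy.keepsArr A = true → threshold.keepsArr A = true →
      (initState 35 6 I ε).arr A = (fun _ => 0) → σ₄.arr A = fun _ => 0 := by
    intro A h1 h2 h3 h4 h5
    rw [f₄.arr A h4, f₃.arr A h3, f₂.arr A h2, f₁.arr A h1, h5]
  have hb₄ : BestSmall I T 0 (σ₄.reg rPb) (σ₄.reg rSb) (σ₄.reg rB) := by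
    have e1 : σ₄.reg rPb = 0 := by
      rw [f₄.reg rPb rfl, f₃.reg rPb rfl, f₂.reg rPb rfl, f₁.reg rPb rfl]; rfl
    have e2 : σ₄.reg rB = 0 := by
      rw [f₄.reg rB rfl, f₃.reg rB rfl, f₂.reg rB rfl, f₁.reg rB rfl]; rfl
    rw [e1, e2, rSb₄]
    exact BestSmall.init hn
  refine Runs.seq (runs_scan hI₄ hnS hMS hT0
    (by rw [f₄.reg rN rfl, f₃.reg rN rfl, f₂.reg rN rfl, f₁.reg rN rfl]; rfl) rM₄ rT₄ hM hb₄
    (fun q => congrFun (hz aB rfl rfl rfl rfl rfl) q)) ?_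
  rintro σ₅ f₅ ⟨hRb₅, hb₅⟩
  have hI₅ := hI₄.of_frame f₅ rfl rfl
  have hmu : (m : ℝ) * (T / m) = T := by field_simp
  refine Runs.seq (runs_clear (I := I) (m := m) (D := D) (T := T) (u := T / m)
    (by rw [f₅.reg rD rfl, f₄.reg rD rfl, f₃.reg rD rfl, f₂.reg rD rfl, rD₁]) hDS hmD hmu.le
    (by rw [f₅.arr aL rfl]; exact hz aL rfl rfl rfl rfl rfl)
    (by rw [f₅.arr aR rfl]; exact hz aR rfl rfl rfl rfl rfl)
    (by rw [f₅.arr aJ rfl]; exact hz aJ rfl rfl rfl rfl rfl)) ?_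
  intro σ₆ f₆ hinv₆
  have hI₆ := hI₅.of_frame f₆ rfl rfl
  have rM1₆ : σ₆.reg rM1 = (m + 1 : ℕ) := by
    rw [f₆.reg rM1 rfl, f₅.reg rM1 rfl, f₄.reg rM1 rfl, f₃.reg rM1 rfl, f₂.reg rM1 rfl, rM1₁]
  have rK₆ : σ₆.reg rK = K := by
    rw [f₆.reg rK rfl, f₅.reg rK rfl, f₄.reg rK rfl, f₃.reg rK rfl, f₂.reg rK rfl, rK₁]
  refine Runs.seq (runs_levels (M := m * K) (m := m) (K := K) (T := T) (u := T / m)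
    hI₆ hnS hMS hm0 hT0 (by positivity)
    (by rw [f₆.reg rM rfl, f₅.reg rM rfl, rM₄]) rM1₆
    (by rw [f₆.reg rMK rfl, f₅.reg rMK rfl, f₄.reg rMK rfl, f₃.reg rMK rfl, f₂.reg rMK rfl, rMK₁])
    rK₆ (by rw [f₆.reg rU rfl, f₅.reg rU rfl, rU₄]) hDdef.ge hDS
    (by rwa [f₆.arr aB rfl]) hM hinv₆) ?_
  rintro σ₇ f₇ ⟨rU₇, X, dag₇, -, sound₇, complete₇⟩
  have hmU : (m : ℝ) * (2 ^ K * (T / m)) = 2 * P := by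
    rw [← hKT]
    field_simp
  have hb₇ : BestSmall I T I.n (σ₇.reg rPb) (σ₇.reg rSb) (σ₇.reg rB) := by
    rwa [f₇.reg rPb rfl, f₇.reg rSb rfl, f₇.reg rB rfl, f₆.reg rPb rfl, f₆.reg rSb rfl,
      f₆.reg rB rfl]
  have hU0 : 0 < 2 ^ K * (T / m) := by positivity
  generalize 2 ^ K * (T / m) = U at *
  obtain ⟨i, him, hiF, hival⟩ := exists_good_cell hT0.le complete₇ hmU
    (fun x hx => I.value_le_two_mul hP hP0.le hx) hb₇
  have hcell : 3 * K * (m + 1) + m < D := by rw [hDdef]; nlinarith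
  have hpb0 : 0 ≤ σ₇.reg rPb := by
    obtain ⟨⟨j, -, ⟨h, -⟩ | ⟨h, -⟩⟩, -⟩ := hb₇
    · rw [h]
      exact (I.profit_mem j).1.le
    · exact h.ge
  refine Runs.seq (runs_pick (m := m) (by rw [f₇.reg rK rfl, rK₆])
    (by rw [f₇.reg rM1 rfl, rM1₆]) rfl (by omega) rU₇ rfl rfl hU0.le hpb0 hb₇.size_pos
    ⟨i, him, hiF⟩) ?_
  rintro σ₈ f₈ ⟨i', him', rArg₈, hiF', rFill₈, hbest⟩
  have hgood := hival.trans (hbest i him hiF)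
  have hw : σ₇.arr aF (3 * K * (m + 1) + i') = I.weight (X (3 * K * (m + 1) + i')) :=
    dag₇.weight_eq _ (by omega) (by linarith)
  have hv := sound₇ i' him' (by linarith)
  have hdD : 3 * K * (m + 1) + i' < D := by omega
  generalize 3 * K * (m + 1) + i' = d at *
  refine Runs.seq (runs_unfoldAll (X := X) (d := d) (D := D) hnS hDS
    (by rw [f₈.reg rD1 rfl, f₇.reg rD1 rfl, f₆.reg rD1 rfl, f₅.reg rD1 rfl, f₄.reg rD1 rfl,
      f₃.reg rD1 rfl, f₂.reg rD1 rfl, rD1₁]) rArg₈ hdD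
    (by rwa [f₈.arr aF rfl, f₈.arr aL rfl, f₈.arr aR rfl, f₈.arr aJ rfl])
    (fun j => by
      rw [f₈.arr aX rfl, f₇.arr aX rfl, f₆.arr aX rfl, f₅.arr aX rfl,
        hz aX rfl rfl rfl rfl rfl])
    (fun j => by
      rw [f₈.arr aC rfl, f₇.arr aC rfl, f₆.arr aC rfl, f₅.arr aC rfl,
        hz aC rfl rfl rfl rfl rfl])) ?_
  intro σ₉ f₉ hx₉
  rw [hw] at hiF' rFill₈ hgood
  obtain ⟨j, k, hj, hk, hfeas, hval⟩ := hb₇.fill hiF'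
  rw [hk] at rFill₈ hgood
  refine Runs.mono (runs_fillUp hnS (by rw [f₉.reg rB rfl, f₈.reg rB rfl, hj])
    (by rw [f₉.reg rFill rfl, rFill₈]) hx₉) le_rfl ?_
  intro τ _ hτ
  refine ⟨_, hτ, hfeas, ?_⟩
  -- Table error and small-item error are at most eP/2 each; together they are at most eP ≤ ε·OPT.
  have hKU : 3 * K * U ≤ e * P / 2 := by
    have h5 : 12 * (K : ℝ) * U ≤ e * m * U := mul_le_mul_of_nonneg_right h12 hU0.le
    have h6 : e * m * U = 2 * (e * P) := by rw [mul_assoc, hmU]; ring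
    linarith
  have he0 : e * P ≤ ε * I.OPT :=
    (mul_le_mul_of_nonneg_right hacc hP0.le).trans (mul_le_mul_of_nonneg_left hPO hε.le)
  linarith

/-! ### Time and space bounds. -/

theorem time_le {n K m : ℕ} (hK : 0 < K) (hKm : K ≤ m) :
    time n K m ≤ 3000 * (n + K * m ^ 2) := by
  have hm : 0 < m := hK.trans_le hKm
  have h0 : (3 * K + 1) * (m + 1) - 1 ≤ (3 * K + 1) * (m + 1) := Nat.sub_le _ _
  have h1 : (3 * K + 1) * (m + 1) ≤ 8 * (K * m) := by nlinarith
  have h2 : K * m ≤ K * m ^ 2 := Nat.mul_le_mul_left _ (Nat.le_self_pow (by norm_num) m)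
  have h3 : K ≤ K * m := Nat.le_mul_of_pos_right _ hm
  have h4 : m ≤ K * m := Nat.le_mul_of_pos_left _ hK
  have h5 : K * ((m + 1) * (m + 1)) ≤ 4 * (K * m ^ 2) := by
    have : (m + 1) * (m + 1) ≤ 4 * m ^ 2 := by nlinarith
    calc K * ((m + 1) * (m + 1)) ≤ K * (4 * m ^ 2) := Nat.mul_le_mul_left _ this
      _ = _ := by ring
  -- Reading all mK classes on every level is no more expensive than the combinations, since K ≤ m.
  have h6 : K * (m * K) ≤ K * m ^ 2 := by
    rw [pow_two]
    exact Nat.mul_le_mul_left _ (Nat.mul_le_mul_left _ hKm)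
  have h7 : K * ((200 * ((m + 1) * (m + 1)) + 100 * (m * K) + 200) + 7) =
      200 * (K * ((m + 1) * (m + 1))) + 100 * (K * (m * K)) + 207 * K := by ring
  unfold time
  rw [h7]
  generalize (3 * K + 1) * (m + 1) - 1 = D' at *
  generalize (3 * K + 1) * (m + 1) = D at *
  generalize K * ((m + 1) * (m + 1)) = Q at *
  generalize K * (m * K) = Q' at *
  omega

theorem numLevels_bounds {ε : ℝ} (hε : 0 < ε) {n : ℕ} (hn : 0 < n) :
    (numLevels ε : ℝ) * tableSize ε ^ 2 ≤
      294912 * (n + 1 / ε ^ 2 * Real.posLog (1 / ε) ^ 3) ∧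
    (numLevels ε : ℝ) * tableSize ε ≤
      1536 * (n + 1 / ε * Real.posLog (1 / ε) ^ 2) := by
  have hn' : (1 : ℝ) ≤ n := by exact_mod_cast hn
  have hl0 : 0 ≤ Real.posLog (1 / ε) := Real.posLog_nonneg
  by_cases h : ε < 1 / 2
  -- Here the logarithm is at least log 2 ≥ 1/2, so it absorbs additive constants: K ≤ 8l and m ≤
  -- 192·l/ε for l = log(1/ε).
  · have hacc : accuracy ε = ε := if_pos h
    have hinv : 2 ≤ 1 / ε := by simpa [hacc] using two_le_inv_accuracy hε
    have hl2 : 1 / 2 ≤ Real.log 2 := by linarith [Real.log_two_gt_d9]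
    have hpl : Real.posLog (1 / ε) = Real.log (1 / ε) :=
      Real.posLog_eq_log (by rw [abs_of_pos (by positivity)]; linarith)
    have hl : 1 / 2 ≤ Real.posLog (1 / ε) := by
      rw [hpl]
      exact hl2.trans (Real.log_le_log (by norm_num) hinv)
    have hK : (numLevels ε : ℝ) ≤ 8 * Real.posLog (1 / ε) := by
      have h1 := Nat.floor_le (logb_accuracy_nonneg hε)
      rw [hacc] at h1
      have h2 : Real.logb 2 (1 / ε) ≤ 2 * Real.posLog (1 / ε) := by
        rw [Real.logb, div_le_iff₀ (by linarith), ← hpl]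
        nlinarith
      rw [numLevels, hacc]
      push_cast
      linarith
    have hm : (tableSize ε : ℝ) ≤ 192 * (Real.posLog (1 / ε) * (1 / ε)) := by
      have h1 := Nat.floor_le (show 0 ≤ 1 / ε by positivity)
      rw [tableSize, hacc]
      push_cast
      calc 12 * (numLevels ε : ℝ) * ((⌊1 / ε⌋₊ : ℝ) + 1)
          ≤ 12 * (8 * Real.posLog (1 / ε)) * (2 * (1 / ε)) := by gcongr; linarith
        _ = _ := by ring
    generalize Real.posLog (1 / ε) = l at *
    constructor
    · calc (numLevels ε : ℝ) * tableSize ε ^ 2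
          ≤ 8 * l * (192 * (l * (1 / ε))) ^ 2 := by gcongr
        _ = 294912 * (1 / ε ^ 2 * l ^ 3) := by ring
        _ ≤ _ := by linarith
    · calc (numLevels ε : ℝ) * tableSize ε
          ≤ 8 * l * (192 * (l * (1 / ε))) := by gcongr
        _ = 1536 * (1 / ε * l ^ 2) := by ring
        _ ≤ _ := by linarith
  -- The logarithm may vanish here, but K = 4 and m = 144 are constants, absorbed by the summand n ≥
  -- 1.
  · have hacc : accuracy ε = 1 / 2 := if_neg h
    have h2 : (1 : ℝ) / (1 / 2) = 2 := by norm_num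
    have hK : numLevels ε = 4 := by
      rw [numLevels, hacc, h2, Real.logb_self_eq_one (by norm_num), Nat.floor_one]
    have hm : tableSize ε = 144 := by
      rw [tableSize, hacc, h2, hK, Nat.floor_ofNat]
    rw [hK, hm]
    have h3 : 0 ≤ 1 / ε ^ 2 * Real.posLog (1 / ε) ^ 3 := by positivity
    have h4 : 0 ≤ 1 / ε * Real.posLog (1 / ε) ^ 2 := by positivity
    constructor <;> norm_num <;> norm_num at h3 h4 <;> linarith

end RealRAM

theorem mainTheorem1 :
    ∃ (r a : ℕ) (P : RealRAM.Prog (r + 2) (a + 3)) (C : ℝ),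
      ∀ (I : UKP) (ε : ℝ), 0 < I.n → 0 < ε →
        ∃ (T M : ℕ) (x : Fin I.n → ℕ),
          RealRAM.Computes P I ε T M x ∧
          I.Feasible x ∧
          (1 - ε) * I.OPT ≤ I.value x ∧
          (T : ℝ) ≤ C * ((I.n : ℝ) + 1 / ε ^ 2 * Real.posLog (1 / ε) ^ 3) ∧
          (M : ℝ) ≤ C * ((I.n : ℝ) + 1 / ε * Real.posLog (1 / ε) ^ 2) := by
  refine ⟨35, 6, RealRAM.fptas, 3000 * 300000, fun I ε hn hε => ?_⟩
  have hK := RealRAM.numLevels_pos ε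
  have hKm := RealRAM.numLevels_le_tableSize ε
  obtain ⟨hT, hM⟩ := RealRAM.numLevels_bounds hε hn
  have hD : RealRAM.numCells ε ≤ 8 * (RealRAM.numLevels ε * RealRAM.tableSize ε) := by
    unfold RealRAM.numCells
    nlinarith
  -- One common array length suffices for the items and the output (n), all table cells (at most
  -- 8Km) and the profit classes (mK).
  obtain ⟨T, hTle, τ, hexec, x, hx, hfeas, hval⟩ :=
    RealRAM.runs_fptas I hn hε
      (S := I.n + 8 * (RealRAM.numLevels ε * RealRAM.tableSize ε)) (by omega) (by omega)
      (by rw [mul_comm]; omega)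
  refine ⟨T, _, x, ⟨_, τ, Nat.le_add_right _ _, rfl, hexec, hx⟩, hfeas, hval, ?_, ?_⟩
  · have h1 : (T : ℝ) ≤ (3000 * (I.n + RealRAM.numLevels ε * RealRAM.tableSize ε ^ 2) : ℕ) := by
      exact_mod_cast hTle.trans (RealRAM.time_le hK hKm)
    push_cast at h1
    have h3 : 0 ≤ 1 / ε ^ 2 * Real.posLog (1 / ε) ^ 3 := by
      have := Real.posLog_nonneg (x := 1 / ε)
      positivity
    have hn0 : (0 : ℝ) ≤ I.n := Nat.cast_nonneg _
    linarith
  · have h4 : 0 ≤ 1 / ε * Real.posLog (1 / ε) ^ 2 := by positivity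
    have hn0 : (1 : ℝ) ≤ I.n := by exact_mod_cast hn
    push_cast
    linarith
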